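/- **Setting.** Let $\mathbf E$ be $\mathbf R^n$ or the space $\mathbf R^{n\times n}$ of real $n\times n$ matrices, with its standard Euclidean structure, let $\|\cdot\|$ be a norm on $\mathbf E$ and $\|\cdot\|_*$ its conjugate norm. For $\kappa\in(1,2]$ and $L>0$ let ${\cal F}_{\|\cdot\|}(\kappa,L)$ be the family of all continuously differentiable convex functions $f:\mathbf E\to\mathbf R$ with $$\|\nabla f(x)-\nabla f(y)\|_*\le L\|x-y\|^{\kappa-1}\qquad\text{for all }x,y\in\mathbf E .$$ An oracle for a family ${\cal F}$ of functions on $\mathbf E$ is a function ${\cal O}(f,x)$ of $f\in{\cal F}$, $x\in\mathbf E$ with values in an arbitrary set; it is *local* if ${\cal O}(f,x)={\cal O}(g,x)$ whenever $f,g\in{\cal F}$ coincide in a neighbourhood of $x$. A $T$-step method ${\cal M}$ ($T\ge1$) generates search points $x_t=X_t\big(\{x_\tau,{\cal O}(f,x_\tau)\}_{\tau=1}^{t-1}\big)$, $1\le t\le T$, with arbitrary deterministic rules $X_t$, and its output is $x_T=x_T({\cal M},f)$. For $X\subset\mathbf E$ put $$\mathrm{Risk}_{{\cal F},X,{\cal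 O}}(T)=\inf_{{\cal M}}\ \sup_{f\in{\cal F}}\Big[f(x_T({\cal M},f))-\inf_{x\in X}f(x)\Big],$$ the infimum being over all $T$-step methods with $x_T({\cal M},f)\in X$ for all $f\in{\cal F}$. For $1\le p\le\infty$ let $\|\cdot\|_p$ be the usual norm on $\mathbf R^n$, and let the Schatten norm $\|x\|_{\mathrm{Sch},p}$ of $x\in\mathbf R^{n\times n}$ be the $p$-norm of the vector of singular values of $x$. **Theorem.** 1. For all $n$, all $1\le p\le\infty$ and all $v\in\mathbf R^n$, $$\min\{\|x\|_{\mathrm{Sch},p}:\ x\in\mathbf R^{n\times n},\ \operatorname{diag}(x)=v\}=\|v\|_p ,$$ that is, the factor norm induced on $\mathbf R^n$ by $\|\cdot\|_{\mathrm{Sch},p}$ via the map taking a matrix to its diagonal is $\|\cdot\|_p$. 2. Let $1\le p\le\infty$, $\kappa\in(1,2]$, $L>0$, $T\ge 1$, let $B$ be the unit ball of $(\mathbf R^n,\|\cdot\|_p)$ and $B^+$ the unit ball of $(\mathbf R^{n\times n},\|\cdot\|_{\mathrm{Sch},p})$. If $r$ is a lower bound on $\mathrm{Risk}_{{\cal F},B,{\cal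 O}}(T)$, ${\cal F}={\cal F}_{\|\cdot\|_p}(\kappa,L)$, valid for every local oracle ${\cal O}$, then $r$ is a lower bound on $\mathrm{Risk}_{{\cal F}^+,B^+,{\cal O}^+}(T)$, ${\cal F}^+={\cal F}_{\|\cdot\|_{\mathrm{Sch},p}}(\kappa,L)$, valid for every local oracle ${\cal O}^+$. 3. There is an absolute constant $c>0$ such that for all $n\ge2$, $1\le T\le n$, $2\le p\le\infty$, $\kappa\in(1,2]$, $L>0$, every convex set $X\subset\mathbf R^{n\times n}$ containing the unit $\|\cdot\|_{\mathrm{Sch},p}$-ball and every local oracle ${\cal O}$ for ${\cal F}={\cal F}_{\|\cdot\|_{\mathrm{Sch},p}}(\kappa,L)$, $$\mathrm{Risk}_{{\cal F},X,{\cal O}}(T)\ \ge\ \frac{c}{[\min(p,\ln n)]^{\kappa-1}}\cdot\frac{L}{T^{\kappa+\frac{\kappa}{p}-1}}$$ (with $\kappa/p=0$ for $p=\infty$). 4. There are absolute constants $c>0$ and $\alpha\in(0,1)$ such that for all $n$, all integers $T$ with $1\le T\le\alpha n$, all $1\le p\le2$, $\kappa\in(1,2]$, $L>0$, every convex set $X\subset\mathbf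 R^{n\times n}$ containing the unit $\|\cdot\|_{\mathrm{Sch},p}$-ball and every local oracle ${\cal O}$ for ${\cal F}={\cal F}_{\|\cdot\|_{\mathrm{Sch},p}}(\kappa,L)$, $$\mathrm{Risk}_{{\cal F},X,{\cal O}}(T)\ \ge\ c\cdot\frac{L}{\ln^{\kappa-1}(T+1)\;T^{\frac{3\kappa}{2}-1}} .$$ -/

import Mathlib

open scoped ENNReal Topology

universe u

-- The ambient (Euclidean) norm on matrices; it only serves to fix the usual topology and derivative.
attribute [local instance] Matrix.frobeniusNormedAddCommGroup Matrix.frobeniusNormedSpace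

namespace OracleComplexity

noncomputable section

/-! ### Smooth convex functions with respect to an arbitrary norm -/

section Smooth

variable {E : Type*} [NormedAddCommGroup E] [NormedSpace ℝ E]

/-- The norm conjugate to `N`, evaluated at a linear form `l`: the supremum of `l h` over the
unit ball of `N`. It takes values in the extended reals, so that it is a genuine supremum. -/
def conjNorm (N : E → ℝ) (l : E →L[ℝ] ℝ) : EReal :=
  ⨆ (h : E) (_ : N h ≤ 1), ((l h : ℝ) : EReal)

/-- The family of all continuously differentiable convex functions on `E` that are
`(κ, L)`-smooth with respect to the norm `N`. The gradient at a point is represented by the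
derivative, that is, by the linear form `h ↦ ⟨∇ f x, h⟩`. -/
def smoothFamily (N : E → ℝ) (κ L : ℝ) : Set (E → ℝ) :=
  {f | ContDiff ℝ 1 f ∧ ConvexOn ℝ Set.univ f ∧
    ∀ x y : E, conjNorm N (fderiv ℝ f x - fderiv ℝ f y) ≤
      ((L * N (x - y) ^ (κ - 1) : ℝ) : EReal)}

end Smooth

/-! ### Oracles, methods, risk -/

section Oracle

variable {E I : Type*}

/-- An oracle `O` for the family `F`, with information space `I`, is local if its answers at `x`
for two functions of the family that agree in a neighbourhood of `x` are the same. -/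
def IsLocal [NormedAddCommGroup E] {F : Set (E → ℝ)} (O : F → E → I) : Prop :=
  ∀ (x : E) (f g : F), (f : E → ℝ) =ᶠ[𝓝 x] (g : E → ℝ) → O f x = O g x

/-- A deterministic method, given by its search rules: from the record of the first `t` search
points and of the answers of the oracle at these points, the rule number `t` produces the next
search point. A `T`-step method is given by the rules with numbers `0, …, T - 1`; the other rules
do not matter for its output. -/
def Method (E I : Type*) : Type _ :=
  (t : ℕ) → (Fin t → E × I) → E

/-- The search point generated by the method `M` after `t` calls of the oracle, when applied to
`f`. In the usual numbering from `1` it is the point `x_{t+1}`. -/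
def searchPoint {F : Set (E → ℝ)} (O : F → E → I) (M : Method E I) (f : F) (t : ℕ) : E :=
  M t fun τ : Fin t => (searchPoint O M f τ, O f (searchPoint O M f τ))
termination_by t
decreasing_by all_goals exact τ.isLt

/-- The approximate solution generated by the `T`-step method, `T ≥ 1`: its last search point
`x_T`. -/
def approxSolution {F : Set (E → ℝ)} (O : F → E → I) (M : Method E I) (f : F) (T : ℕ) : E :=
  searchPoint O M f (T - 1)

/-- The optimal value of `f` over `X`, equal to `-∞` if `f` is unbounded below on `X`. -/
def opt (X : Set E) (f : E → ℝ) : EReal :=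
  ⨅ x ∈ X, ((f x : ℝ) : EReal)

/-- The `T`-step minimax risk of the family of problems of minimizing a function `f ∈ F` over `X`
with the oracle `O`: the infimum over all `T`-step methods whose approximate solutions belong to
`X` of the worst-case inaccuracy over `F`. -/
def minimaxRisk (F : Set (E → ℝ)) (X : Set E) (O : F → E → I) (T : ℕ) : EReal :=
  ⨅ (M : Method E I) (_ : ∀ f : F, approxSolution O M f T ∈ X),
    ⨆ f : F, (((f : E → ℝ) (approxSolution O M f T) : ℝ) : EReal) - opt X f

end Oracle

/-! ### The norms -/

/-- The norm `‖v‖_p` on `ℝⁿ`, `1 ≤ p ≤ ∞`. -/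
def lpNorm {n : ℕ} (p : ℝ≥0∞) (v : Fin n → ℝ) : ℝ :=
  ‖WithLp.toLp p v‖

/-- The Schatten `p`-norm of a square matrix: the `p`-norm of the vector of its singular values. -/
def schattenNorm {n : ℕ} (p : ℝ≥0∞) (x : Matrix (Fin n) (Fin n) ℝ) : ℝ :=
  lpNorm p fun i : Fin n => (Matrix.toEuclideanLin x).singularValues i

end

end OracleComplexity

namespace OracleComplexity

/-! ### A smooth approximation of the maximum of finitely many numbers -/

section SmoothMax

/-! The lower bounds come from a resisting oracle that plays with smoothed maxima of linear forms.
Minimizing `s + ∑ (y i - s)₊ ^ m / m` over `s` gives a convex C¹ function that lies between `max y -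
1` and `max y`. Its gradient is a probability vector and is Hölder continuous for the `m`-norm with
a constant of order `m ^ (κ - 1)` (`sum_weight_sub_mul_le`). It also has an exact cutoff:
coordinates at least 1 below the maximum have no influence (`smoothMax_le_of_forall_eq_or`).

The hard function is a multiple of this smoothed maximum of the forms `l * (± a (σ i)) - 2 * i`. At
each new search point the adversary assigns the next index to the unused form of largest modulus and
chooses its sign so that its value is nonnegative. The shifts put all later forms below the cutoff
near that point, so a local oracle learns nothing about them (`exists_resisting`). After `T` steps
the value at the output is not very negative, while a point of `X` where all forms have modulus `ρ`
and the adverse sign is much better. Balancing the scales gives a bound of order `L * ρ ^ κ / (m *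
T) ^ (κ - 1)` (`le_minimaxRisk_of_forms`).

For `p ≥ 2` the forms are diagonal entries and `ρ = T ^ (-1/p)`. For `p ≤ 2` they are entries of one
row: a one-row matrix has rank at most one, its Schatten norms all equal the Euclidean norm of the
row, and `ρ = T ^ (-1/2)` for every `p`. In both cases `m` is chosen so that the `m`-norm of the
forms is at most three times the Schatten norm.

The statement on factor norms follows from the singular value decomposition and Birkhoff's theorem
(`lpNorm_diag_le_schattenNorm`). The transfer of bounds composes functions with the diagonal map and
simulates a matrix oracle on vectors by an answer covering a whole fibre of that map
(`le_minimaxRisk_of_factor`). -/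

theorem pow_add_mul_sub_le_pow (m : ℕ) {a b : ℝ} (ha : 0 ≤ a) (hb : 0 ≤ b) :
    a ^ m + m * a ^ (m - 1) * (b - a) ≤ b ^ m := by
  induction m with
  | zero => simp
  | succ k ih =>
    rcases Nat.eq_zero_or_pos k with rfl | hk
    · simp
    obtain ⟨j, rfl⟩ : ∃ j, k = j + 1 := ⟨k - 1, by omega⟩
    have h1 := mul_le_mul_of_nonneg_left ih hb
    have h2 : 0 ≤ ((j : ℝ) + 1) * a ^ j * (b - a) ^ 2 := by positivity
    simp only [Nat.add_sub_cancel] at h1 ⊢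
    push_cast at h1 ⊢
    have e : b ^ (j + 1 + 1) = b * b ^ (j + 1) := by ring
    have h3 : b * (a ^ (j + 1) + (j + 1) * a ^ j * (b - a)) -
        (a ^ (j + 1 + 1) + (j + 1 + 1) * a ^ (j + 1) * (b - a)) =
        ((j : ℝ) + 1) * a ^ j * (b - a) ^ 2 := by ring
    linarith

/-- The tangent inequality for the convex function `u ↦ u₊ ^ m / m`. -/
theorem posPart_pow_tangent {m : ℕ} (hm : 2 ≤ m) (w u : ℝ) :
    max w 0 ^ m / m + max w 0 ^ (m - 1) * (u - w) ≤ max u 0 ^ m / m := by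
  have hm0 : (0 : ℝ) < m := by positivity
  have h := pow_add_mul_sub_le_pow m (le_max_right w 0) (le_max_right u 0)
  have h1 : max w 0 ^ (m - 1) * (u - w) ≤ max w 0 ^ (m - 1) * (max u 0 - max w 0) := by
    rcases le_total w 0 with hw | hw
    · rw [max_eq_right hw, zero_pow (by omega)]; simp
    · rw [max_eq_left hw]
      gcongr
      exact le_max_left _ _
  have h2 : max w 0 ^ m / m + max w 0 ^ (m - 1) * (max u 0 - max w 0) =
      (max w 0 ^ m + m * max w 0 ^ (m - 1) * (max u 0 - max w 0)) / m := by
    field_simp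
  calc _ ≤ _ := add_le_add le_rfl h1
    _ = _ := h2
    _ ≤ _ := by gcongr

/-- The quadratic upper bound for the convex function `u ↦ u₊ ^ m / m`. -/
theorem posPart_pow_upper {m : ℕ} (hm : 2 ≤ m) (w d : ℝ) :
    max (w + d) 0 ^ m / m ≤ max w 0 ^ m / m + max w 0 ^ (m - 1) * d +
      m * ((max w 0 + |d|) ^ (m - 2) * d ^ 2) := by
  set a := max w 0 with ha
  have ha0 : 0 ≤ a := le_max_right _ _
  have hm0 : (0 : ℝ) < m := by positivity
  have hm1 : (1 : ℝ) ≤ m := by exact_mod_cast (by omega : 1 ≤ m)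
  obtain ⟨j, rfl⟩ : ∃ j, m = j + 2 := ⟨m - 2, by omega⟩
  simp only [Nat.add_sub_cancel, show j + 2 - 1 = j + 1 by omega]
  -- The right side involves `w` only through `a`, so `w` may be raised to `a`.
  have hmono : max (w + d) 0 ≤ max (a + d) 0 := by
    gcongr; exact le_max_left _ _
  have h0 : max (w + d) 0 ^ (j + 2) ≤ max (a + d) 0 ^ (j + 2) := by gcongr
  have h0' : max (w + d) 0 ^ (j + 2) / ((j + 2 : ℕ) : ℝ) ≤
    max (a + d) 0 ^ (j + 2) / ((j + 2 : ℕ) : ℝ) := by gcongr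
  refine h0'.trans ?_
  rcases le_total 0 (a + d) with h | h
  · rw [max_eq_left h]
    have t := pow_add_mul_sub_le_pow (j + 2) h ha0
    have t2 : ((a + d) ^ (j + 1) - a ^ (j + 1)) * d ≤
        (j + 2 : ℕ) * ((a + |d|) ^ j * d ^ 2) := by
      have s1 := pow_add_mul_sub_le_pow (j + 1) h ha0
      have s2 := pow_add_mul_sub_le_pow (j + 1) ha0 h
      simp only [Nat.add_sub_cancel] at s1 s2
      have hle : a + d ≤ a + |d| := by gcongr; exact le_abs_self d
      have hle2 : a ≤ a + |d| := by have := abs_nonneg d; linarith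
      have hP : (0 : ℝ) ≤ (a + |d|) ^ j * d ^ 2 := by positivity
      have hc : ((j + 1 : ℕ) : ℝ) * ((a + |d|) ^ j * d ^ 2) ≤
          (j + 2 : ℕ) * ((a + |d|) ^ j * d ^ 2) := by
        gcongr; omega
      refine le_trans ?_ hc
      rcases le_total 0 d with hd | hd
      · have p1 : (a + d) ^ (j + 1) - a ^ (j + 1) ≤ (j + 1 : ℕ) * (a + d) ^ j * d := by
          linarith
        have p2 : (a + d) ^ j ≤ (a + |d|) ^ j := by gcongr
        calc ((a + d) ^ (j + 1) - a ^ (j + 1)) * d ≤ ((j + 1 : ℕ) * (a + d) ^ j * d) * d := by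
              gcongr
          _ = (j + 1 : ℕ) * ((a + d) ^ j * d ^ 2) := by ring
          _ ≤ _ := by gcongr
      · have p1 : a ^ (j + 1) - (a + d) ^ (j + 1) ≤ (j + 1 : ℕ) * a ^ j * (-d) := by
          linarith
        have p2 : a ^ j ≤ (a + |d|) ^ j := by gcongr
        calc ((a + d) ^ (j + 1) - a ^ (j + 1)) * d =
              (a ^ (j + 1) - (a + d) ^ (j + 1)) * (-d) := by ring
          _ ≤ ((j + 1 : ℕ) * a ^ j * (-d)) * (-d) := by
              apply mul_le_mul_of_nonneg_right p1; linarith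
          _ = (j + 1 : ℕ) * (a ^ j * d ^ 2) := by ring
          _ ≤ _ := by gcongr
    -- Tangent inequality at `a + d`, evaluated at `a`; `t2` then pays for moving the slope from `a
    -- + d` back to `a`.
    have e : (a + d) ^ (j + 2) / ((j + 2 : ℕ) : ℝ) ≤
        a ^ (j + 2) / ((j + 2 : ℕ) : ℝ) + (a + d) ^ (j + 1) * d := by
      rw [div_add' _ _ _ hm0.ne']
      gcongr
      have : a - (a + d) = -d := by ring
      rw [this, show j + 2 - 1 = j + 1 by omega] at t
      linarith
    linarith
  · rw [max_eq_right h, zero_pow (by omega), zero_div]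
    have hd : a ≤ |d| := by rw [abs_of_nonpos (by linarith)]; linarith
    have h1 : -(a ^ (j + 1) * d) ≤ (a + |d|) ^ j * d ^ 2 := by
      have p2 : a ^ j ≤ (a + |d|) ^ j := by
        gcongr; have := abs_nonneg d; linarith
      have : -d = |d| := by rw [abs_of_nonpos (by linarith)]
      calc -(a ^ (j + 1) * d) = a ^ j * a * |d| := by rw [← this]; ring
        _ ≤ (a + |d|) ^ j * |d| * |d| := by gcongr
        _ = _ := by rw [mul_assoc, ← pow_two, sq_abs]
    have h2 : (a + |d|) ^ j * d ^ 2 ≤ (j + 2 : ℕ) * ((a + |d|) ^ j * d ^ 2) :=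
      le_mul_of_one_le_left (by positivity) hm1
    have h3 : 0 ≤ a ^ (j + 2) / ((j + 2 : ℕ) : ℝ) := by positivity
    linarith

variable {ι : Type*} [Fintype ι]

/-- The penalized level `s + ∑ i, (y i - s)₊ ^ m / m`. -/
noncomputable def penalizedLevel (m : ℕ) (y : ι → ℝ) (s : ℝ) : ℝ :=
  s + ∑ i, max (y i - s) 0 ^ m / m

/-- A minimizer of the penalized level. -/
noncomputable def level (m : ℕ) (y : ι → ℝ) : ℝ :=
  Classical.epsilon fun s : ℝ => ∑ i, max (y i - s) 0 ^ (m - 1) = 1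

/-- The partial derivatives of the smooth maximum. -/
noncomputable def weight (m : ℕ) (y : ι → ℝ) (i : ι) : ℝ :=
  max (y i - level m y) 0 ^ (m - 1)

/-- The smooth maximum: the minimum of the penalized level. -/
noncomputable def smoothMax (m : ℕ) (y : ι → ℝ) : ℝ :=
  penalizedLevel m y (level m y)

theorem exists_level [Nonempty ι] {k : ℕ} (hk : k ≠ 0) (y : ι → ℝ) :
    ∃ s : ℝ, ∑ i, max (y i - s) 0 ^ k = 1 := by
  have hc : Continuous fun s : ℝ => ∑ i, max (y i - s) 0 ^ k := by fun_prop
  refine mem_range_of_exists_le_of_exists_ge hc ?_ ?_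
  · obtain ⟨b, hb⟩ := (Set.finite_range y).bddAbove
    refine ⟨b, ?_⟩
    rw [Finset.sum_eq_zero]
    · norm_num
    · intro i _
      rw [max_eq_right (sub_nonpos.2 (hb ⟨i, rfl⟩)), zero_pow hk]
  · obtain ⟨i⟩ := ‹Nonempty ι›
    refine ⟨y i - 1, ?_⟩
    refine le_trans ?_ (Finset.single_le_sum (f := fun j => max (y j - (y i - 1)) 0 ^ k)
      (fun j _ => by positivity) (Finset.mem_univ i))
    simp

variable {m : ℕ} (hm : 2 ≤ m)
include hm

theorem sum_weight [Nonempty ι] (y : ι → ℝ) : ∑ i, weight m y i = 1 :=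
  Classical.epsilon_spec (exists_level (by omega) y)

omit hm in
theorem weight_nonneg (y : ι → ℝ) (i : ι) : 0 ≤ weight m y i := by
  unfold weight; positivity

/-- Nonnegative weights with sum 1 cannot exceed 1. Hence the level is at least `max y - 1`, which
is the source of the cutoff. -/
theorem sub_level_le_one [Nonempty ι] (y : ι → ℝ) (i : ι) : y i - level m y ≤ 1 := by
  have h : weight m y i ≤ 1 := by
    rw [← sum_weight hm y]
    exact Finset.single_le_sum (fun j _ => weight_nonneg y j) (Finset.mem_univ i)
  by_contra! hlt
  have : 1 < weight m y i := by
    unfold weight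
    exact one_lt_pow₀ (lt_max_of_lt_left hlt) (by omega)
  linarith

theorem sum_posPart_pow_le_one [Nonempty ι] (y : ι → ℝ) :
    ∑ i, max (y i - level m y) 0 ^ m ≤ 1 := by
  rw [← sum_weight hm y]
  refine Finset.sum_le_sum fun i _ => ?_
  exact pow_le_pow_of_le_one (le_max_right _ _) (max_le (sub_level_le_one hm y i) zero_le_one)
    (by omega)

/-- The subgradient inequality for the smooth maximum. -/
theorem smoothMax_add_le_penalizedLevel [Nonempty ι] (y y' : ι → ℝ) (s : ℝ) :
    smoothMax m y + ∑ i, weight m y i * (y' i - y i) ≤ penalizedLevel m y' s := by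
  have h : ∑ i, (max (y i - level m y) 0 ^ m / m +
      weight m y i * ((y' i - s) - (y i - level m y))) ≤ ∑ i, max (y' i - s) 0 ^ m / m :=
    Finset.sum_le_sum fun i _ => posPart_pow_tangent hm _ _
  -- As the weights sum to 1, the change of level comes out as `level m y - s` and cancels against
  -- the linear term of the penalized level.
  have e : ∑ i, weight m y i * ((y' i - s) - (y i - level m y)) =
      ∑ i, weight m y i * (y' i - y i) + (level m y - s) := by
    have : ∑ i, weight m y i * ((y' i - s) - (y i - level m y)) =
      ∑ i, (weight m y i * (y' i - y i) + weight m y i * (level m y - s)) :=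
      Finset.sum_congr rfl fun i _ => by ring
    rw [this, Finset.sum_add_distrib, ← Finset.sum_mul, sum_weight hm, one_mul]
  rw [Finset.sum_add_distrib, e] at h
  unfold smoothMax penalizedLevel
  linarith

theorem smoothMax_le_penalizedLevel [Nonempty ι] (y : ι → ℝ) (s : ℝ) :
    smoothMax m y ≤ penalizedLevel m y s := by
  simpa using smoothMax_add_le_penalizedLevel hm y y s

theorem smoothMax_subgradient [Nonempty ι] (y y' : ι → ℝ) :
    smoothMax m y + ∑ i, weight m y i * (y' i - y i) ≤ smoothMax m y' :=
  smoothMax_add_le_penalizedLevel hm y y' _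

theorem smoothMax_le [Nonempty ι] {y : ι → ℝ} {b : ℝ} (hb : ∀ i, y i ≤ b) :
    smoothMax m y ≤ b := by
  refine (smoothMax_le_penalizedLevel hm y b).trans ?_
  unfold penalizedLevel
  rw [Finset.sum_eq_zero, add_zero]
  intro i _
  rw [max_eq_right (sub_nonpos.2 (hb i)), zero_pow (by omega), zero_div]

theorem sub_one_le_smoothMax [Nonempty ι] (y : ι → ℝ) (i : ι) : y i - 1 ≤ smoothMax m y := by
  have h := sub_level_le_one hm y i
  have : 0 ≤ ∑ i, max (y i - level m y) 0 ^ m / (m : ℝ) :=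
    Finset.sum_nonneg fun i _ => by positivity
  unfold smoothMax penalizedLevel
  linarith

/-- Test `y'` with the level of `y`: a coordinate below `y k - 1` is below that level and costs
nothing. Used in both directions, this makes two hard functions equal near a point. -/
theorem smoothMax_le_of_forall_eq_or [Nonempty ι] {y y' : ι → ℝ} (k : ι)
    (h : ∀ i, y' i = y i ∨ y' i ≤ y k - 1) : smoothMax m y' ≤ smoothMax m y := by
  refine (smoothMax_le_penalizedLevel hm y' (level m y)).trans ?_
  unfold smoothMax penalizedLevel
  gcongr (_ + ∑ i, ?_ / _) with i
  rcases h i with h | h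
  · rw [h]
  · have := sub_level_le_one hm y k
    rw [max_eq_right (by linarith), zero_pow (by omega)]
    positivity

/-- Freeze the level of `y` and add the one-dimensional upper bounds. The remaining sum is at most
`4 * D ^ 2` because `(1 + D) ^ m ≤ exp (m * D) ≤ e`, so only one factor `m` is lost. -/
theorem smoothMax_add_le_of_small [Nonempty ι] (y d : ι → ℝ) {D : ℝ} (hD : 0 ≤ D)
    (hd : ∑ i, |d i| ^ m ≤ D ^ m) (hmD : m * D ≤ 1) :
    smoothMax m (y + d) ≤ smoothMax m y + ∑ i, weight m y i * d i + 4 * (m * D) * D := by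
  have hm0 : (0 : ℝ) < m := by positivity
  set w : ι → ℝ := fun i => max (y i - level m y) 0 with hw
  have hw0 : ∀ i, 0 ≤ w i := fun i => le_max_right _ _
  have key : ∑ i, (w i + |d i|) ^ (m - 2) * d i ^ 2 ≤ 4 * D ^ 2 := by
    rcases hD.eq_or_lt with rfl | hD
    · rw [zero_pow (by omega)] at hd
      have : ∀ i, d i = 0 := fun i => by
        have h1 : |d i| ^ m ≤ 0 := (Finset.single_le_sum (f := fun i => |d i| ^ m)
          (fun j _ => by positivity) (Finset.mem_univ i)).trans hd
        have h2 := pow_eq_zero_iff (by omega) |>.1 (le_antisymm h1 (by positivity))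
        exact abs_eq_zero.1 h2
      simp [this]
    set e : ι → ℝ := fun i => |d i| / D with he
    have he0 : ∀ i, 0 ≤ e i := fun i => by positivity
    have hde : ∀ i, |d i| = D * e i := fun i => by simp only [he]; field_simp
    have hse : ∑ i, e i ^ m ≤ 1 := by
      simp only [he, div_pow]
      rw [← Finset.sum_div]
      exact (div_le_one (by positivity)).2 hd
    -- Convexity of the `m`-th power, with `w i + D * e i` written as `1 + D` times a convex
    -- combination of `w i` and `e i`.
    have h1 : ∀ i, (w i + |d i|) ^ m ≤ (1 + D) ^ (m - 1) * (w i ^ m + D * e i ^ m) := by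
      intro i
      have hc := (convexOn_pow m (𝕜 := ℝ)).2 (hw0 i) (he0 i)
        (show 0 ≤ 1 / (1 + D) by positivity) (show 0 ≤ D / (1 + D) by positivity) (by field_simp)
      have e1 : w i + |d i| = (1 + D) * ((1 / (1 + D)) • w i + (D / (1 + D)) • e i) := by
        rw [hde]; simp only [smul_eq_mul]; field_simp
      rw [e1, mul_pow]
      calc _ ≤ (1 + D) ^ m * ((1 / (1 + D)) • w i ^ m + (D / (1 + D)) • e i ^ m) := by
            gcongr
        _ = _ := by
          obtain ⟨j, rfl⟩ : ∃ j, m = j + 1 := ⟨m - 1, by omega⟩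
          simp only [smul_eq_mul, Nat.add_sub_cancel]
          field_simp
          ring
    have h2 : ∑ i, (w i + |d i|) ^ m ≤ 3 := by
      calc ∑ i, (w i + |d i|) ^ m ≤ ∑ i, (1 + D) ^ (m - 1) * (w i ^ m + D * e i ^ m) :=
            Finset.sum_le_sum fun i _ => h1 i
        _ = (1 + D) ^ (m - 1) * (∑ i, w i ^ m + D * ∑ i, e i ^ m) := by
            rw [← Finset.mul_sum, Finset.sum_add_distrib, ← Finset.mul_sum]
        _ ≤ (1 + D) ^ (m - 1) * (1 + D * 1) := by
            gcongr
            exact sum_posPart_pow_le_one hm y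
        _ = (1 + D) ^ m := by
            rw [mul_one, ← pow_succ]; congr 1; omega
        _ ≤ Real.exp D ^ m := by
            gcongr; rw [add_comm]; exact Real.add_one_le_exp D
        _ = Real.exp (m * D) := by rw [← Real.exp_nat_mul]
        _ ≤ Real.exp 1 := by gcongr
        _ ≤ 3 := Real.exp_one_lt_three.le
    have h3 : ∀ i, (w i + |d i|) ^ (m - 2) * d i ^ 2 ≤
        D ^ 2 * ((w i + |d i|) ^ m + e i ^ m) := by
      intro i
      have : d i ^ 2 = D ^ 2 * e i ^ 2 := by rw [← sq_abs, hde, mul_pow]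
      rw [this]
      have hA : 0 ≤ w i + |d i| := add_nonneg (hw0 i) (abs_nonneg _)
      generalize w i + |d i| = A at hA
      -- Both factors are bounded by the larger of `A` and `e i`.
      have : A ^ (m - 2) * e i ^ 2 ≤ A ^ m + e i ^ m := by
        have e2 : m - 2 + 2 = m := by omega
        have hA' := pow_nonneg hA m
        have he' := pow_nonneg (he0 i) m
        rcases le_total A (e i) with h | h
        · calc A ^ (m - 2) * e i ^ 2 ≤ e i ^ (m - 2) * e i ^ 2 := by
                have := he0 i; gcongr
            _ = e i ^ m := by rw [← pow_add, e2]
            _ ≤ _ := by linarith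
        · calc A ^ (m - 2) * e i ^ 2 ≤ A ^ (m - 2) * A ^ 2 := by
                have := he0 i; gcongr
            _ = A ^ m := by rw [← pow_add, e2]
            _ ≤ _ := by linarith
      calc _ = D ^ 2 * (A ^ (m - 2) * e i ^ 2) := by ring
        _ ≤ _ := by gcongr
    calc _ ≤ ∑ i, D ^ 2 * ((w i + |d i|) ^ m + e i ^ m) := Finset.sum_le_sum fun i _ => h3 i
      _ = D ^ 2 * (∑ i, (w i + |d i|) ^ m + ∑ i, e i ^ m) := by
          rw [← Finset.mul_sum, Finset.sum_add_distrib]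
      _ ≤ D ^ 2 * (3 + 1) := by gcongr
      _ = _ := by ring
  refine (smoothMax_le_penalizedLevel hm (y + d) (level m y)).trans ?_
  have h := Finset.sum_le_sum (s := Finset.univ)
    fun i _ => posPart_pow_upper hm (y i - level m y) (d i)
  rw [Finset.sum_add_distrib, Finset.sum_add_distrib, ← Finset.mul_sum] at h
  unfold smoothMax penalizedLevel
  have e : ∀ i, (y + d) i - level m y = y i - level m y + d i := fun i => by
    simp only [Pi.add_apply]; ring
  simp only [e]
  have k2 := mul_le_mul_of_nonneg_left key hm0.le
  have e3 : ∑ i, weight m y i * d i = ∑ i, max (y i - level m y) 0 ^ (m - 1) * d i := rfl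
  rw [e3]
  nlinarith

omit hm in
theorem sum_mul_le_of_sum_eq_one {p d : ι → ℝ} (hp : ∀ i, 0 ≤ p i) (hs : ∑ i, p i = 1) {D : ℝ}
    (hd : ∀ i, d i ≤ D) : ∑ i, p i * d i ≤ D := by
  calc ∑ i, p i * d i ≤ ∑ i, p i * D :=
        Finset.sum_le_sum fun i _ => mul_le_mul_of_nonneg_left (hd i) (hp i)
    _ = D := by rw [← Finset.sum_mul, hs, one_mul]

theorem abs_le_of_sum_pow_le {d : ι → ℝ} {D : ℝ} (hD : 0 ≤ D)
    (hd : ∑ i, |d i| ^ m ≤ D ^ m) (i : ι) : |d i| ≤ D := by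
  refine le_of_pow_le_pow_left₀ (by omega : m ≠ 0) hD (le_trans ?_ hd)
  exact Finset.single_le_sum (f := fun i => |d i| ^ m) (fun j _ => by positivity)
    (Finset.mem_univ i)

/-- Interpolation: for `m * D ≤ 1` the quadratic bound is sharper than required, and for `m * D ≥ 1`
the Lipschitz bound `2 * D` suffices. -/
theorem smoothMax_add_le [Nonempty ι] (y d : ι → ℝ) {D θ : ℝ} (hD : 0 ≤ D)
    (hd : ∑ i, |d i| ^ m ≤ D ^ m) (hθ : 0 ≤ θ) (hθ1 : θ ≤ 1) :
    smoothMax m (y + d) ≤ smoothMax m y + ∑ i, weight m y i * d i + 4 * (m * D) ^ θ * D := by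
  have hmD0 : (0 : ℝ) ≤ m * D := by positivity
  rcases le_total ((m : ℝ) * D) 1 with h | h
  · refine (smoothMax_add_le_of_small hm y d hD hd h).trans ?_
    gcongr
    rcases hmD0.eq_or_lt with h0 | h0
    · rw [← h0]; positivity
    · simpa using Real.rpow_le_rpow_of_exponent_ge h0 h hθ1
  · have h1 := smoothMax_subgradient hm (y + d) y
    have h2 : ∑ i, weight m (y + d) i * -(y i - (y + d) i) ≤ D :=
      sum_mul_le_of_sum_eq_one (weight_nonneg _) (sum_weight hm _) fun i => by
        have := (le_abs_self _).trans (abs_le_of_sum_pow_le hm hD hd i)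
        simpa using this
    have h3 : ∑ i, weight m y i * -d i ≤ D :=
      sum_mul_le_of_sum_eq_one (weight_nonneg _) (sum_weight hm _) fun i =>
        (neg_le_abs _).trans (abs_le_of_sum_pow_le hm hD hd i)
    simp only [mul_neg, Finset.sum_neg_distrib] at h2 h3
    have h4 : 1 ≤ ((m : ℝ) * D) ^ θ := Real.one_le_rpow h hθ
    nlinarith

/-- The gradient of the smooth maximum is Hölder continuous with respect to the `m`-norm. -/
theorem sum_weight_sub_mul_le [Nonempty ι] (y y' v : ι → ℝ) {D θ : ℝ} (hD : 0 ≤ D)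
    (hd : ∑ i, |y' i - y i| ^ m ≤ D ^ m) (hv : ∑ i, |v i| ^ m ≤ 1) (hθ : 0 ≤ θ) (hθ1 : θ ≤ 1) :
    ∑ i, (weight m y i - weight m y' i) * v i ≤ 8 * (m * D) ^ θ := by
  rcases hD.eq_or_lt with rfl | hD
  · have : y' = y := by
      ext i
      have h := abs_le_of_sum_pow_le hm le_rfl hd i
      exact sub_eq_zero.1 (abs_eq_zero.1 (le_antisymm h (abs_nonneg _)))
    subst this
    simp only [sub_self, zero_mul, Finset.sum_const_zero]
    positivity
  -- Three-point argument: go up from `y` to `y'`, then from `y'` along `D • v`, and compare with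
  -- the tangent at `y`. Taking the second step of length `D` makes both errors equal.
  have h1 := smoothMax_add_le hm y (y' - y) hD.le hd hθ hθ1
  have h2 := smoothMax_add_le hm y' (D • v) hD.le (θ := θ) (by
    simp only [Pi.smul_apply, smul_eq_mul, abs_mul, mul_pow, abs_of_pos hD]
    rw [← Finset.mul_sum]
    exact mul_le_of_le_one_right (by positivity) hv) hθ hθ1
  have h3 := smoothMax_subgradient hm y (y' + D • v)
  rw [add_sub_cancel] at h1
  have e1 : ∑ i, weight m y i * ((y' + D • v) i - y i) =
      ∑ i, weight m y i * (y' - y) i + D * ∑ i, weight m y i * v i := by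
    rw [Finset.mul_sum, ← Finset.sum_add_distrib]
    refine Finset.sum_congr rfl fun i _ => ?_
    simp only [Pi.add_apply, Pi.smul_apply, Pi.sub_apply, smul_eq_mul]; ring
  have e2 : ∑ i, weight m y' i * (D • v) i = D * ∑ i, weight m y' i * v i := by
    rw [Finset.mul_sum]
    refine Finset.sum_congr rfl fun i _ => ?_
    simp only [Pi.smul_apply, smul_eq_mul]; ring
  rw [e1] at h3
  rw [e2] at h2
  have e3 : ∑ i, (weight m y i - weight m y' i) * v i =
      ∑ i, weight m y i * v i - ∑ i, weight m y' i * v i := by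
    rw [← Finset.sum_sub_distrib]
    exact Finset.sum_congr rfl fun i _ => by ring
  rw [e3]
  refine le_of_mul_le_mul_left ?_ hD
  linarith

/-- The crude constant is harmless: it serves only differentiability and continuity of the
derivative, not the smoothness constant. -/
theorem sum_abs_pow_le_card_mul_norm_pow [Nonempty ι] (d : ι → ℝ) :
    ∑ i, |d i| ^ m ≤ (Fintype.card ι * ‖d‖) ^ m := by
  have hc : (1 : ℝ) ≤ Fintype.card ι := by exact_mod_cast Fintype.card_pos
  calc ∑ i, |d i| ^ m ≤ ∑ _i : ι, ‖d‖ ^ m := by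
        gcongr with i; exact norm_le_pi_norm d i
    _ = Fintype.card ι * ‖d‖ ^ m := by simp
    _ ≤ Fintype.card ι ^ m * ‖d‖ ^ m := by
        gcongr; exact le_self_pow₀ hc (by omega)
    _ = _ := by rw [mul_pow]

/-- The differential of the smooth maximum. -/
theorem hasFDerivAt_smoothMax [Nonempty ι] (y : ι → ℝ) :
    HasFDerivAt (smoothMax m : (ι → ℝ) → ℝ)
      (∑ i, weight m y i • ContinuousLinearMap.proj (R := ℝ) (φ := fun _ : ι => ℝ) i) y := by
  rw [hasFDerivAt_iff_isLittleO_nhds_zero]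
  have hO : (fun d : ι → ℝ => smoothMax m (y + d) - smoothMax m y -
      (∑ i, weight m y i • ContinuousLinearMap.proj (R := ℝ) (φ := fun _ : ι => ℝ) i) d)
      =O[𝓝 0] fun d => ‖d‖ ^ 2 := by
    refine Asymptotics.IsBigO.of_bound (4 * m * Fintype.card ι ^ 2) (Filter.Eventually.of_forall ?_)
    intro d
    have h1 := smoothMax_add_le hm y d (by positivity) (sum_abs_pow_le_card_mul_norm_pow hm d) zero_le_one le_rfl
    have h2 := smoothMax_subgradient hm y (y + d)
    simp only [Pi.add_apply, add_sub_cancel_left, Real.rpow_one] at h1 h2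
    have e : (∑ i, weight m y i • ContinuousLinearMap.proj (R := ℝ) (φ := fun _ : ι => ℝ) i) d =
        ∑ i, weight m y i * d i := by simp
    rw [e, Real.norm_of_nonneg (by linarith), Real.norm_of_nonneg (by positivity)]
    linarith
  refine hO.trans_isLittleO ?_
  exact Asymptotics.isLittleO_norm_pow_id one_lt_two

theorem continuous_weight [Nonempty ι] (i : ι) :
    Continuous fun y : ι → ℝ => weight m y i := by
  classical
  have hb : ∀ y y' : ι → ℝ, weight m y i - weight m y' i ≤
      8 * (m * (Fintype.card ι * ‖y' - y‖)) := by
    intro y y'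
    have h := sum_weight_sub_mul_le hm y y' (Pi.single i 1) (D := Fintype.card ι * ‖y' - y‖)
      (θ := 1) (by positivity) (sum_abs_pow_le_card_mul_norm_pow hm (y' - y)) ?_ zero_le_one le_rfl
    · simpa [Pi.single_apply] using h
    · rw [Finset.sum_eq_single i]
      · simp
      · intro j _ hj; simp [hj]; omega
      · simp
  rw [continuous_iff_continuousAt]
  intro y
  rw [ContinuousAt, tendsto_iff_dist_tendsto_zero]
  have ht : Filter.Tendsto (fun y' : ι → ℝ => 8 * (m * (Fintype.card ι * ‖y' - y‖))) (𝓝 y) (𝓝 0) := by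
    have : Continuous fun y' : ι → ℝ => 8 * ((m : ℝ) * (Fintype.card ι * ‖y' - y‖)) := by fun_prop
    simpa using this.tendsto y
  refine squeeze_zero (fun _ => dist_nonneg) (fun y' => ?_) ht
  rw [Real.dist_eq, abs_le]
  have h1 := hb y y'
  have h2 := hb y' y
  rw [norm_sub_rev] at h2
  constructor <;> linarith

theorem contDiff_smoothMax [Nonempty ι] : ContDiff ℝ 1 (smoothMax m : (ι → ℝ) → ℝ) := by
  rw [contDiff_one_iff_fderiv]
  refine ⟨fun y => (hasFDerivAt_smoothMax hm y).differentiableAt, ?_⟩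
  have : fderiv ℝ (smoothMax m : (ι → ℝ) → ℝ) = fun y => ∑ i, weight m y i •
      ContinuousLinearMap.proj (R := ℝ) (φ := fun _ : ι => ℝ) i :=
    funext fun y => (hasFDerivAt_smoothMax hm y).fderiv
  rw [this]
  exact continuous_finsetSum _ fun i _ => (continuous_weight hm i).smul continuous_const

theorem convexOn_smoothMax [Nonempty ι] :
    ConvexOn ℝ Set.univ (smoothMax m : (ι → ℝ) → ℝ) := by
  refine ⟨convex_univ, fun x _ y _ a b ha hb hab => ?_⟩
  set z := a • x + b • y
  have h1 := mul_le_mul_of_nonneg_left (smoothMax_subgradient hm z x) ha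
  have h2 := mul_le_mul_of_nonneg_left (smoothMax_subgradient hm z y) hb
  have e : a * ∑ i, weight m z i * (x i - z i) + b * ∑ i, weight m z i * (y i - z i) = 0 := by
    rw [Finset.mul_sum, Finset.mul_sum, ← Finset.sum_add_distrib]
    refine Finset.sum_eq_zero fun i _ => ?_
    have : z i = a * x i + b * y i := rfl
    have : a * (x i - z i) + b * (y i - z i) = 0 := by
      rw [this]; obtain rfl : b = 1 - a := by linarith
      ring
    linear_combination weight m z i * this
  simp only [smul_eq_mul]
  have : a * smoothMax m z + b * smoothMax m z = smoothMax m z := by rw [← add_mul, hab, one_mul]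
  linarith

end SmoothMax

end OracleComplexity

namespace OracleComplexity

/-! ### Hard functions and the resisting oracle -/

section Resisting

theorem searchPoint_congr {E I : Type*} {F : Set (E → ℝ)} (O : F → E → I) (M : Method E I)
    {f g : F} {t : ℕ}
    (h : ∀ s < t, O f (searchPoint O M f s) = O g (searchPoint O M f s)) :
    ∀ s ≤ t, searchPoint O M g s = searchPoint O M f s := by
  intro s
  induction s using Nat.strong_induction_on with
  | _ s ih =>
    intro hs
    rw [searchPoint, searchPoint]
    congr 1
    funext τ
    have hτ := τ.isLt
    rw [ih τ hτ (by omega), h τ (by omega)]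

variable {E : Type*} [NormedAddCommGroup E] [NormedSpace ℝ E] {T : ℕ}

/-- The affine forms whose smooth maximum is the hard function: signed and permuted copies of the
forms `a i`, with decreasing shifts. -/
noncomputable def hardForm (a : Fin T → E →L[ℝ] ℝ) (l : ℝ) (σ : Equiv.Perm (Fin T))
    (ε : Fin T → ℝ) (x : E) (i : Fin T) : ℝ :=
  l * (ε i * a (σ i) x) - 2 * (i : ℕ)

/-- The hard function. -/
noncomputable def hardFun (m : ℕ) (b : ℝ) (a : Fin T → E →L[ℝ] ℝ) (l : ℝ)
    (σ : Equiv.Perm (Fin T)) (ε : Fin T → ℝ) (x : E) : ℝ :=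
  b * smoothMax m (hardForm a l σ ε x)

theorem hasFDerivAt_hardForm (a : Fin T → E →L[ℝ] ℝ) (l : ℝ) (σ : Equiv.Perm (Fin T))
    (ε : Fin T → ℝ) (x : E) :
    HasFDerivAt (hardForm a l σ ε)
      (ContinuousLinearMap.pi fun i => l • ε i • a (σ i)) x := by
  rw [hasFDerivAt_pi]
  intro i
  exact ((((a (σ i)).hasFDerivAt (x := x)).const_mul (ε i)).const_mul l).sub_const _

theorem continuous_hardForm (a : Fin T → E →L[ℝ] ℝ) (l : ℝ) (σ : Equiv.Perm (Fin T))
    (ε : Fin T → ℝ) : Continuous (hardForm a l σ ε) :=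
  continuous_iff_continuousAt.2 fun x => (hasFDerivAt_hardForm a l σ ε x).continuousAt

variable {m : ℕ} (hm : 2 ≤ m) {a : Fin T → E →L[ℝ] ℝ} {l b : ℝ}
include hm

theorem fderiv_hardFun_apply [NeZero T] (σ : Equiv.Perm (Fin T)) (ε : Fin T → ℝ) (x h : E) :
    fderiv ℝ (hardFun m b a l σ ε) x h =
      b * ∑ i, weight m (hardForm a l σ ε x) i * (l * (ε i * a (σ i) h)) := by
  have := ((hasFDerivAt_smoothMax hm (hardForm a l σ ε x)).comp x
    (hasFDerivAt_hardForm a l σ ε x)).const_mul b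
  have e : fderiv ℝ (hardFun m b a l σ ε) x = _ := HasFDerivAt.fderiv this
  rw [e]
  simp

/-- Signs and permutations preserve the `m`-norm, so `hA` carries over to the hard forms. With `θ =
κ - 1` one factor `l * K` comes from the direction and `(l * K) ^ (κ - 1)` from the increment. -/
theorem hardFun_mem_smoothFamily [NeZero T] {N : E → ℝ} (hN : ∀ h, 0 ≤ N h) {K : ℝ} (hK : 0 < K)
    (hA : ∀ h, ∑ i, |a i h| ^ m ≤ (K * N h) ^ m) (hl : 0 < l) (hb : 0 < b) {κ L : ℝ}
    (hκ : 1 < κ) (hκ2 : κ ≤ 2) (hL : 8 * (b * ((m : ℝ) ^ (κ - 1) * (l * K) ^ κ)) ≤ L)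
    (σ : Equiv.Perm (Fin T)) {ε : Fin T → ℝ} (hε : ∀ i, |ε i| = 1) :
    hardFun m b a l σ ε ∈ smoothFamily N κ L := by
  have hm0 : (0 : ℝ) < m := by positivity
  have hA' : ∀ h, ∑ i, |ε i * a (σ i) h| ^ m ≤ (K * N h) ^ m := by
    intro h
    simp only [abs_mul, hε, one_mul]
    rw [Equiv.sum_comp σ fun i => |a i h| ^ m]
    exact hA h
  refine ⟨?_, ?_, ?_⟩
  · have h1 : ContDiff ℝ 1 (hardForm a l σ ε) := by
      rw [contDiff_pi]
      intro i
      exact (contDiff_const.mul (contDiff_const.mul (a (σ i)).contDiff)).sub contDiff_const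
    exact contDiff_const.mul ((contDiff_smoothMax hm).comp h1)
  · refine ⟨convex_univ, fun x _ y _ s t hs ht hst => ?_⟩
    have e : hardForm a l σ ε (s • x + t • y) =
        s • hardForm a l σ ε x + t • hardForm a l σ ε y := by
      funext i
      obtain rfl : t = 1 - s := by linarith
      simp only [hardForm, map_add, map_smul, Pi.add_apply, Pi.smul_apply, smul_eq_mul]
      ring
    have h := (convexOn_smoothMax hm).2 (Set.mem_univ (hardForm a l σ ε x))
      (Set.mem_univ (hardForm a l σ ε y)) hs ht hst
    have h2 := mul_le_mul_of_nonneg_left h hb.le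
    simp only [hardFun, e, smul_eq_mul] at h2 ⊢
    linarith
  · intro x y
    refine iSup₂_le fun h hh => EReal.coe_le_coe_iff.2 ?_
    rw [sub_apply, fderiv_hardFun_apply hm, fderiv_hardFun_apply hm]
    have hv : ∑ i, |ε i * a (σ i) h / K| ^ m ≤ 1 := by
      simp only [abs_div, div_pow, ← Finset.sum_div, abs_of_pos hK]
      refine (div_le_one (by positivity)).2 ((hA' h).trans ?_)
      have := hN h
      gcongr
      exact mul_le_of_le_one_right hK.le hh
    have hd : ∑ i, |hardForm a l σ ε y i - hardForm a l σ ε x i| ^ m ≤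
        (l * (K * N (x - y))) ^ m := by
      have e : ∀ i, |hardForm a l σ ε y i - hardForm a l σ ε x i| =
          l * |ε i * a (σ i) (x - y)| := by
        intro i
        rw [abs_sub_comm]
        rw [← abs_of_pos hl, ← abs_mul, abs_of_pos hl]
        congr 1
        simp only [hardForm, map_sub]; ring
      simp only [e, mul_pow l, ← Finset.mul_sum]
      gcongr
      exact hA' _
    have hD : 0 ≤ l * (K * N (x - y)) := by have := hN (x - y); positivity
    have key := sum_weight_sub_mul_le hm _ _ _ hD hd hv (θ := κ - 1) (by linarith) (by linarith)
    have e1 : b * ∑ i, weight m (hardForm a l σ ε x) i * (l * (ε i * a (σ i) h)) -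
        b * ∑ i, weight m (hardForm a l σ ε y) i * (l * (ε i * a (σ i) h)) =
        b * (l * K) * ∑ i, (weight m (hardForm a l σ ε x) i - weight m (hardForm a l σ ε y) i) *
          (ε i * a (σ i) h / K) := by
      rw [← mul_sub, ← Finset.sum_sub_distrib, Finset.mul_sum, Finset.mul_sum]
      refine Finset.sum_congr rfl fun i _ => ?_
      field_simp
    rw [e1]
    calc _ ≤ b * (l * K) * (8 * (m * (l * (K * N (x - y)))) ^ (κ - 1)) := by gcongr
      _ = 8 * (b * ((m : ℝ) ^ (κ - 1) * (l * K) ^ κ)) * N (x - y) ^ (κ - 1) := by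
        have hlK : 0 < l * K := by positivity
        rw [Real.mul_rpow hm0.le hD, ← mul_assoc l, Real.mul_rpow hlK.le (hN _)]
        have : (l * K) ^ κ = (l * K) * (l * K) ^ (κ - 1) := by
          rw [← Real.rpow_one_add' hlK.le (by linarith)]; congr 1; ring
        rw [this]; ring
      _ ≤ _ := by
        gcongr
        exact Real.rpow_nonneg (hN _) _

/-- At `x` every form with index `j ≥ t > s` is at least 2 below form `s`, because of the shifts. By
continuity the gap stays above 1 nearby, where the cutoff discards these forms. -/
theorem eventually_hardFun_le [NeZero T] (hl : 0 < l) (hb : 0 < b) {σ σ' : Equiv.Perm (Fin T)}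
    {ε ε' : Fin T → ℝ} (hε' : ∀ i, |ε' i| = 1) {t : ℕ} {s : Fin T}
    (hs : (s : ℕ) < t) (heq : ∀ j : Fin T, (j : ℕ) < t → σ' j = σ j ∧ ε' j = ε j) {x : E}
    (h' : ∀ j ≥ s, |a (σ' j) x| ≤ ε' s * a (σ' s) x) :
    ∀ᶠ z in 𝓝 x, hardFun m b a l σ' ε' z ≤ hardFun m b a l σ ε z := by
  have h1 : ∀ j : Fin T, t ≤ (j : ℕ) →
      ∀ᶠ z in 𝓝 x, hardForm a l σ' ε' z j < hardForm a l σ' ε' z s - 1 := by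
    intro j hj
    have c1 : Continuous fun z => hardForm a l σ' ε' z j :=
      (continuous_apply j).comp (continuous_hardForm a l σ' ε')
    have c2 : Continuous fun z => hardForm a l σ' ε' z s - 1 :=
      ((continuous_apply s).comp (continuous_hardForm a l σ' ε')).sub continuous_const
    refine c1.continuousAt.eventually_lt c2.continuousAt ?_
    have hjs : ((s : ℕ) : ℝ) + 1 ≤ ((j : ℕ) : ℝ) := by exact_mod_cast (by omega)
    have k1 : ε' j * a (σ' j) x ≤ ε' s * a (σ' s) x := by
      refine le_trans (le_abs_self _) ?_
      rw [abs_mul, hε', one_mul]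
      exact h' j (Fin.le_def.2 (by omega))
    have k2 := mul_le_mul_of_nonneg_left k1 hl.le
    unfold hardForm
    linarith
  have h2 : ∀ᶠ z in 𝓝 x, ∀ j : Fin T, t ≤ (j : ℕ) →
      hardForm a l σ' ε' z j < hardForm a l σ' ε' z s - 1 := by
    rw [Filter.eventually_all]
    intro j
    by_cases hj : t ≤ (j : ℕ)
    · filter_upwards [h1 j hj] with z hz _ using hz
    · exact Filter.Eventually.of_forall fun z hz => absurd hz hj
  filter_upwards [h2] with z hz
  refine mul_le_mul_of_nonneg_left (smoothMax_le_of_forall_eq_or hm s fun j => ?_) hb.le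
  have e : ∀ j : Fin T, (j : ℕ) < t → hardForm a l σ' ε' z j = hardForm a l σ ε z j := by
    intro j hj
    unfold hardForm
    rw [(heq j hj).1, (heq j hj).2]
  rcases lt_or_ge (j : ℕ) t with hj | hj
  · exact Or.inl (e j hj)
  · right
    rw [← e s hs]
    exact (hz j hj).le

/-- The resisting oracle: for every method there is a hard function such that at each step `s` the
form number `s` is the largest one among those that have not been used before. -/
theorem exists_resisting [NeZero T] (hl : 0 < l) (hb : 0 < b) {F : Set (E → ℝ)}
    (hF : ∀ (σ : Equiv.Perm (Fin T)) (ε : Fin T → ℝ), (∀ i, |ε i| = 1) →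
      hardFun m b a l σ ε ∈ F) {I : Type*} {O : F → E → I} (hO : IsLocal O) (M : Method E I)
    (t : ℕ) (ht : t ≤ T) :
    ∃ (σ : Equiv.Perm (Fin T)) (ε : Fin T → ℝ) (hε : ∀ i, |ε i| = 1),
      ∀ s : Fin T, (s : ℕ) < t → ∀ j ≥ s,
        |a (σ j) (searchPoint O M ⟨_, hF σ ε hε⟩ s)| ≤
          ε s * a (σ s) (searchPoint O M ⟨_, hF σ ε hε⟩ s) := by
  induction t with
  | zero => exact ⟨1, fun _ => 1, by simp, by simp⟩
  | succ t ih =>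
    obtain ⟨σ, ε, hε, H⟩ := ih (by omega)
    set f : F := ⟨_, hF σ ε hε⟩ with hf
    set x := searchPoint O M f t with hx
    set u : Fin T := ⟨t, by omega⟩ with hu
    -- The adversary's move: among the forms not yet fixed, the one of largest modulus at `x` is
    -- swapped into position `t`, with the sign that makes it nonnegative.
    obtain ⟨k, hk, hmax⟩ := (Finset.univ.filter fun j : Fin T => u ≤ j).exists_max_image
      (fun j => |a (σ j) x|) ⟨u, by simp⟩
    simp only [Finset.mem_filter, Finset.mem_univ, true_and] at hk hmax
    set σ' : Equiv.Perm (Fin T) := (Equiv.swap u k).trans σ with hσ'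
    set ε' : Fin T → ℝ := Function.update ε u (if 0 ≤ a (σ k) x then 1 else -1) with hε'
    have hε1 : ∀ i, |ε' i| = 1 := by
      intro i
      by_cases hi : i = u
      · subst hi
        simp only [hε', Function.update_self]
        split_ifs <;> simp
      · simp only [hε', Function.update_of_ne hi, hε]
    have heq : ∀ j : Fin T, (j : ℕ) < t → σ' j = σ j ∧ ε' j = ε j := by
      intro j hj
      have h1 : j ≠ u := by rintro rfl; simp [hu] at hj
      have h2 : j ≠ k := by rintro rfl; rw [Fin.le_def] at hk; simp [hu] at hk; omega
      exact ⟨by simp [hσ', Equiv.swap_apply_of_ne_of_ne h1 h2],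
        by simp [hε', Function.update_of_ne h1]⟩
    have hswap : ∀ s : Fin T, s ≤ u → ∀ j ≥ s, Equiv.swap u k j ≥ s := by
      intro s hs j hj
      rw [Equiv.swap_apply_def]
      split_ifs
      · exact hs.trans hk
      · exact hs
      · exact hj
    have Hσ' : ∀ s : Fin T, (s : ℕ) < t → ∀ j ≥ s, |a (σ' j) (searchPoint O M f s)| ≤
        ε' s * a (σ' s) (searchPoint O M f s) := by
      intro s hs j hj
      rw [(heq s hs).1, (heq s hs).2]
      exact H s hs _ (hswap s (Fin.le_def.2 hs.le) j hj)
    set g : F := ⟨_, hF σ' ε' hε1⟩ with hg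
    -- The old and the new function coincide near each earlier search point, so locality leaves the
    -- trajectory unchanged up to and including the point number `t`.
    have hsp : ∀ s ≤ t, searchPoint O M g s = searchPoint O M f s := by
      refine searchPoint_congr O M fun s hs => hO _ _ _ ?_
      have hsT : s < T := by omega
      have e1 := eventually_hardFun_le hm hl hb hε1 (s := ⟨s, hsT⟩) hs heq (Hσ' ⟨s, hsT⟩ hs)
      have e2 := eventually_hardFun_le hm hl hb hε (s := ⟨s, hsT⟩) hs
        (fun j hj => ⟨(heq j hj).1.symm, (heq j hj).2.symm⟩) (H ⟨s, hsT⟩ hs)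
      filter_upwards [e1, e2] with z h1 h2
      exact le_antisymm h2 h1
    refine ⟨σ', ε', hε1, fun s hs j hj => ?_⟩
    rw [← hg, hsp s (by omega)]
    rcases Nat.lt_succ_iff_lt_or_eq.1 hs with hs | hs
    · exact Hσ' s hs j hj
    · obtain rfl : s = u := Fin.ext hs
      have e1 : σ' u = σ k := by simp [hσ']
      have e2 : ε' u * a (σ k) x = |a (σ k) x| := by
        simp only [hε', Function.update_self]
        split_ifs with h0
        · rw [one_mul, abs_of_nonneg h0]
        · rw [abs_of_neg (not_le.1 h0)]; ring
      have hxu : searchPoint O M f (u : ℕ) = x := rfl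
      rw [hxu, e1, e2]
      exact hmax _ (hswap u le_rfl j hj)

/-- The lower bound on the risk in terms of linear forms `a i` that are controlled by the norm and
take all combinations of signs on `X`, up to the factor `ρ`. -/
theorem le_minimaxRisk_of_forms (hT : 1 ≤ T) {N : E → ℝ} (hN : ∀ h, 0 ≤ N h) {K : ℝ}
    (hK : 0 < K) (hA : ∀ h, ∑ i, |a i h| ^ m ≤ (K * N h) ^ m) {κ L : ℝ} (hκ : 1 < κ)
    (hκ2 : κ ≤ 2) (hL : 0 < L) {ρ : ℝ} (hρ : 0 < ρ) {X : Set E}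
    (hX : ∀ η : Fin T → ℝ, (∀ i, |η i| = 1) → ∃ x ∈ X, ∀ i, a i x = ρ * η i)
    {I : Type*} {O : smoothFamily N κ L → E → I} (hO : IsLocal O) :
    ((L * ρ ^ κ / (4 * (4 * K) ^ κ * (m * T) ^ (κ - 1)) : ℝ) : EReal) ≤
      minimaxRisk (smoothFamily N κ L) X O T := by
  have : NeZero T := ⟨by omega⟩
  have hm0 : (0 : ℝ) < m := by positivity
  have hT0 : (0 : ℝ) < T := by exact_mod_cast hT
  -- This scale gives `l * ρ = 4 * T`, twice the total shift allowed at the output; `b` is then the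
  -- largest factor compatible with the constant `L`.
  set l : ℝ := 4 * T / ρ with hl'
  have hl : 0 < l := by positivity
  set b : ℝ := L / (8 * ((m : ℝ) ^ (κ - 1) * (l * K) ^ κ)) with hb'
  have hb : 0 < b := by positivity
  have hbL : 8 * (b * ((m : ℝ) ^ (κ - 1) * (l * K) ^ κ)) ≤ L := by
    rw [hb']; apply le_of_eq; field_simp
  have hF := fun (σ : Equiv.Perm (Fin T)) (ε : Fin T → ℝ) (hε : ∀ i, |ε i| = 1) =>
    hardFun_mem_smoothFamily hm hN hK hA hl hb hκ hκ2 hbL σ hε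
  refine le_iInf₂ fun M _ => ?_
  obtain ⟨σ, ε, hε, H⟩ := exists_resisting hm hl hb hF hO M T le_rfl
  set f : smoothFamily N κ L := ⟨_, hF σ ε hε⟩ with hf
  refine le_trans ?_ (le_iSup _ f)
  -- With these signs form number `i` takes the value `-(4 * T) - 2 * i` at `z`.
  obtain ⟨z, hzX, hz⟩ := hX (fun i => -ε (σ.symm i)) (fun i => by rw [abs_neg]; exact hε _)
  set s : Fin T := ⟨T - 1, by omega⟩ with hs
  set x := approxSolution O M f T with hx
  have hxs : x = searchPoint O M f s := rfl
  -- The output is search point number `T - 1`, where the form with that index is at least `-2 * (T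
  -- - 1)`; smoothing loses at most 1.
  have h1 : b * (-(2 * T)) ≤ (f : E → ℝ) x := by
    have := sub_one_le_smoothMax hm (hardForm a l σ ε x) s
    have h2 := (abs_nonneg _).trans (H s (by simp [hs]; omega) s le_rfl)
    rw [← hxs] at h2
    have h3 := mul_nonneg hl.le h2
    have h4 : ((s : ℕ) : ℝ) = T - 1 := by
      rw [hs]; push_cast [Nat.cast_sub hT]; rfl
    refine mul_le_mul_of_nonneg_left ?_ hb.le
    refine le_trans ?_ this
    unfold hardForm
    rw [h4]
    linarith
  have h2 : (f : E → ℝ) z ≤ b * (-(4 * T)) := by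
    refine mul_le_mul_of_nonneg_left (smoothMax_le hm fun i => ?_) hb.le
    unfold hardForm
    rw [hz, Equiv.symm_apply_apply]
    have e : ε i * ε i = 1 := by rw [← abs_mul_abs_self, hε, one_mul]
    have e2 : l * ρ = 4 * T := by rw [hl']; field_simp
    have : l * (ε i * (ρ * -ε i)) = -(4 * T) := by linear_combination (-l * ρ) * e - e2
    rw [this]
    have : (0 : ℝ) ≤ (i : ℕ) := by positivity
    linarith
  have h3 : L * ρ ^ κ / (4 * (4 * K) ^ κ * (m * T) ^ (κ - 1)) ≤ (f : E → ℝ) x - (f : E → ℝ) z := by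
    have e : L * ρ ^ κ / (4 * (4 * K) ^ κ * (m * T) ^ (κ - 1)) = b * (2 * T) := by
      have e1 : l * K = (4 * K) * T / ρ := by rw [hl']; ring
      have e2 : (T : ℝ) ^ κ = T * (T : ℝ) ^ (κ - 1) := by
        rw [← Real.rpow_one_add' hT0.le (by linarith)]; congr 1; ring
      rw [hb', e1, Real.div_rpow (by positivity) hρ.le,
        Real.mul_rpow (by positivity : 0 ≤ 4 * K) hT0.le, e2, Real.mul_rpow hm0.le hT0.le]
      field_simp
      norm_num
    rw [e]
    linarith
  refine le_trans (EReal.coe_le_coe_iff.2 h3) ?_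
  rw [EReal.coe_sub]
  exact EReal.sub_le_sub le_rfl (iInf₂_le z hzX)

end Resisting

end OracleComplexity

namespace OracleComplexity

/-! ### Singular values and the Schatten norms -/

section Schatten

variable {n : ℕ}

theorem lpNorm_mono {p : ℝ≥0∞} (hp : 1 ≤ p) {v w : Fin n → ℝ} (h : ∀ i, |v i| ≤ |w i|) :
    lpNorm p v ≤ lpNorm p w := by
  have : Fact (1 ≤ p) := ⟨hp⟩
  unfold lpNorm
  rcases eq_or_ne p ∞ with rfl | hp'
  · rw [PiLp.norm_eq_ciSup]
    exact Real.iSup_le (fun i => (h i).trans (PiLp.norm_apply_le (WithLp.toLp ∞ w) i))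
      (norm_nonneg _)
  · have h0 : 0 < p.toReal := ENNReal.toReal_pos (by positivity) hp'
    rw [PiLp.norm_eq_sum h0, PiLp.norm_eq_sum h0]
    gcongr with i
    exact h i

theorem abs_le_lpNorm {p : ℝ≥0∞} (hp : 1 ≤ p) (v : Fin n → ℝ) (i : Fin n) :
    |v i| ≤ lpNorm p v :=
  have : Fact (1 ≤ p) := ⟨hp⟩
  PiLp.norm_apply_le (WithLp.toLp p v) i

theorem lpNorm_nonneg {p : ℝ≥0∞} (hp : 1 ≤ p) (v : Fin n → ℝ) : 0 ≤ lpNorm p v :=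
  have : Fact (1 ≤ p) := ⟨hp⟩
  norm_nonneg _

theorem lpNorm_comp_perm {p : ℝ≥0∞} (hp : 1 ≤ p) (σ : Equiv.Perm (Fin n)) (v : Fin n → ℝ) :
    lpNorm p (v ∘ σ) = lpNorm p v := by
  have : Fact (1 ≤ p) := ⟨hp⟩
  have h := (LinearIsometryEquiv.piLpCongrLeft p ℝ ℝ σ.symm).norm_map (WithLp.toLp p v)
  exact h

/-- By Birkhoff's theorem `P` is a convex combination of permutation matrices, which are isometries;
the norm is convex. -/
theorem lpNorm_mulVec_le {p : ℝ≥0∞} (hp : 1 ≤ p) {P : Matrix (Fin n) (Fin n) ℝ}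
    (hP : P ∈ doublyStochastic ℝ (Fin n)) (v : Fin n → ℝ) :
    lpNorm p (P.mulVec v) ≤ lpNorm p v := by
  have : Fact (1 ≤ p) := ⟨hp⟩
  let f : Matrix (Fin n) (Fin n) ℝ →ₗ[ℝ] PiLp p fun _ : Fin n => ℝ :=
    (WithLp.linearEquiv p ℝ (Fin n → ℝ)).symm.toLinearMap ∘ₗ
      (Matrix.mulVecBilin ℝ ℝ).flip v
  have hf : ∀ Q : Matrix (Fin n) (Fin n) ℝ, ‖f Q‖ = lpNorm p (Q.mulVec v) := fun _ => rfl
  have hc : Convex ℝ (f ⁻¹' {z | ‖z‖ ≤ lpNorm p v}) := by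
    have := (convex_closedBall (0 : PiLp p fun _ : Fin n => ℝ) (lpNorm p v)).linear_preimage f
    simpa [Metric.closedBall, dist_zero_right] using this
  have hs : {Q | ∃ σ : Equiv.Perm (Fin n), σ.permMatrix ℝ = Q} ⊆
      f ⁻¹' {z | ‖z‖ ≤ lpNorm p v} := by
    rintro _ ⟨σ, rfl⟩
    have e : (σ.permMatrix ℝ).mulVec v = v ∘ σ := Matrix.permMatrix_mulVec σ
    rw [Set.mem_preimage, Set.mem_ofPred_eq, hf, e]
    exact (lpNorm_comp_perm hp σ v).le
  have hP' := convexHull_min hs hc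
  rw [← doublyStochastic_eq_convexHull_permMatrix] at hP'
  exact hP' hP

/-- The singular value decomposition of an endomorphism of a Euclidean space. -/
theorem exists_singularValueDecomposition {E : Type*} [NormedAddCommGroup E]
    [InnerProductSpace ℝ E] [FiniteDimensional ℝ E] (hn : Module.finrank ℝ E = n)
    (A : E →ₗ[ℝ] E) :
    ∃ u v : OrthonormalBasis (Fin n) ℝ E, ∀ k, A (v k) = A.singularValues k • u k := by
  set v := A.isSymmetric_adjoint_comp_self.eigenvectorBasis hn with hv
  have hin : ∀ j k, inner ℝ (A (v j)) (A (v k)) =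
      if j = k then A.singularValues k ^ 2 else 0 := by
    intro j k
    have h1 : (LinearMap.adjoint A ∘ₗ A) (v k) = (A.singularValues k ^ 2) • v k := by
      rw [hv, A.isSymmetric_adjoint_comp_self.apply_eigenvectorBasis hn k,
        A.sq_singularValues_fin hn]
      rfl
    rw [← LinearMap.adjoint_inner_right, ← LinearMap.comp_apply, h1, inner_smul_right,
      v.inner_eq_ite]
    split_ifs <;> simp
  set w : Fin n → E := fun k => (A.singularValues k)⁻¹ • A (v k) with hw
  set s : Set (Fin n) := {k | A.singularValues k ≠ 0} with hs
  have ho : Orthonormal ℝ (s.domRestrict w) := by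
    classical
    rw [orthonormal_iff_ite]
    rintro ⟨j, hj⟩ ⟨k, hk⟩
    simp only [Set.domRestrict_apply, hw, inner_smul_left, inner_smul_right, hin,
      Subtype.mk.injEq, conj_trivial]
    split_ifs with h
    · subst h
      have : A.singularValues j ≠ 0 := hj
      field_simp
    · simp
  -- Normalized images exist only for nonzero singular values; the rest of the basis is arbitrary,
  -- since `A (v k) = 0` there.
  obtain ⟨u, hu⟩ := ho.exists_orthonormalBasis_extension_of_card_eq (by simp [hn])
  refine ⟨u, v, fun k => ?_⟩
  by_cases hk : A.singularValues k = 0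
  · rw [hk, zero_smul]
    have h := hin k k
    rw [if_pos rfl, hk] at h
    exact inner_self_eq_zero.1 (h.trans (by norm_num))
  · rw [hu k hk, hw, smul_smul, mul_inv_cancel₀ hk, one_smul]

/-- The singular value decomposition of a matrix in coordinates. -/
theorem exists_singularValueDecomposition_coord (x : Matrix (Fin n) (Fin n) ℝ) :
    ∃ U V : Fin n → Fin n → ℝ,
      ((∀ k, ∑ i, U k i ^ 2 = 1) ∧ ∀ w : Fin n → ℝ, ∑ k, (∑ i, U k i * w i) ^ 2 = ∑ i, w i ^ 2) ∧
      ((∀ k, ∑ i, V k i ^ 2 = 1) ∧ ∀ w : Fin n → ℝ, ∑ k, (∑ i, V k i * w i) ^ 2 = ∑ i, w i ^ 2) ∧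
      (∀ i j, x i j = ∑ k : Fin n, (Matrix.toEuclideanLin x).singularValues k * (U k i * V k j)) ∧
      ∀ k : Fin n, (Matrix.toEuclideanLin x).singularValues k =
        ∑ i, U k i * ∑ j, x i j * V k j := by
  obtain ⟨u, v, h⟩ := exists_singularValueDecomposition (n := n) (by simp)
    (Matrix.toEuclideanLin x)
  have hb : ∀ b : OrthonormalBasis (Fin n) ℝ (EuclideanSpace ℝ (Fin n)),
      (∀ k, ∑ i, b k i ^ 2 = 1) ∧
        ∀ w : Fin n → ℝ, ∑ k, (∑ i, b k i * w i) ^ 2 = ∑ i, w i ^ 2 := by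
    intro b
    constructor
    · intro k
      have := b.norm_eq_one k
      rw [← EuclideanSpace.real_norm_sq_eq, this, one_pow]
    · intro w
      have h1 := b.sum_sq_norm_inner_right (WithLp.toLp 2 w)
      rw [EuclideanSpace.real_norm_sq_eq] at h1
      simpa [PiLp.inner_apply, mul_comm] using h1
  have hcoord : ∀ k i, ∑ j, x i j * v k j = (Matrix.toEuclideanLin x).singularValues k * u k i := by
    intro k i
    have := congrArg (fun z : EuclideanSpace ℝ (Fin n) => z i) (h k)
    simpa [Matrix.toLpLin_apply, Matrix.mulVec, dotProduct] using this
  refine ⟨fun k i => u k i, fun k i => v k i, hb u, hb v, fun i j => ?_, fun k => ?_⟩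
  · have h1 := v.sum_repr' (EuclideanSpace.single j (1 : ℝ))
    have h2 := congrArg (fun z => Matrix.toEuclideanLin x z i) h1
    simp only [map_sum, map_smul, h] at h2
    have e : Matrix.toEuclideanLin x (EuclideanSpace.single j 1) i = x i j := by
      simp [Matrix.toLpLin_apply]
    rw [e] at h2
    rw [← h2]
    simp only [WithLp.ofLp_sum, Finset.sum_apply, WithLp.ofLp_smul, Pi.smul_apply, smul_eq_mul]
    refine Finset.sum_congr rfl fun k _ => ?_
    have e2 : inner ℝ (v k) (EuclideanSpace.single j (1 : ℝ)) = v k j := by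
      simp [EuclideanSpace.inner_single_right]
    rw [e2]; ring
  · simp only [hcoord]
    have : ∑ i, u k i * ((Matrix.toEuclideanLin x).singularValues k * u k i) =
        (Matrix.toEuclideanLin x).singularValues k * ∑ i, u k i ^ 2 := by
      rw [Finset.mul_sum]
      exact Finset.sum_congr rfl fun i _ => by ring
    rw [this, (hb u).1 k, mul_one]

theorem sum_sq_eq_one_of_parseval {U : Fin n → Fin n → ℝ}
    (h : ∀ w : Fin n → ℝ, ∑ k, (∑ i, U k i * w i) ^ 2 = ∑ i, w i ^ 2) (i : Fin n) :
    ∑ k, U k i ^ 2 = 1 := by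
  simpa [Pi.single_apply] using h (Pi.single i 1)

theorem schattenNorm_nonneg {p : ℝ≥0∞} (hp : 1 ≤ p) (x : Matrix (Fin n) (Fin n) ℝ) :
    0 ≤ schattenNorm p x :=
  lpNorm_nonneg hp _

/-- These averages dominate `|U k i * V k i|`, the coefficients relating a diagonal to the singular
values. -/
theorem mem_doublyStochastic_of_sq {U V : Fin n → Fin n → ℝ} (hU : ∀ k, ∑ i, U k i ^ 2 = 1)
    (hU' : ∀ i, ∑ k, U k i ^ 2 = 1) (hV : ∀ k, ∑ i, V k i ^ 2 = 1)
    (hV' : ∀ i, ∑ k, V k i ^ 2 = 1) :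
    Matrix.of (fun k i => (U k i ^ 2 + V k i ^ 2) / 2) ∈ doublyStochastic ℝ (Fin n) := by
  rw [mem_doublyStochastic_iff_sum]
  refine ⟨fun k i => by simp only [Matrix.of_apply]; positivity, fun k => ?_, fun i => ?_⟩
  · simp only [Matrix.of_apply]
    rw [← Finset.sum_div, Finset.sum_add_distrib, hU, hV]; norm_num
  · simp only [Matrix.of_apply]
    rw [← Finset.sum_div, Finset.sum_add_distrib, hU', hV']; norm_num

theorem abs_mul_le_half_add_sq (a b : ℝ) : |a * b| ≤ (a ^ 2 + b ^ 2) / 2 := by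
  rw [abs_mul]
  nlinarith [sq_nonneg (|a| - |b|), sq_abs a, sq_abs b]

/-- The decomposition gives `x i i = ∑ k, σ k * U k i * V k i`, so the diagonal is dominated
entrywise by a doubly stochastic image of the singular values. -/
theorem lpNorm_diag_le_schattenNorm {p : ℝ≥0∞} (hp : 1 ≤ p) (x : Matrix (Fin n) (Fin n) ℝ) :
    lpNorm p x.diag ≤ schattenNorm p x := by
  obtain ⟨U, V, hU, hV, hx, -⟩ := exists_singularValueDecomposition_coord x
  have hP := mem_doublyStochastic_of_sq (sum_sq_eq_one_of_parseval hU.2) hU.1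
    (sum_sq_eq_one_of_parseval hV.2) hV.1
  refine le_trans (lpNorm_mono hp fun i => ?_) (lpNorm_mulVec_le hp hP _)
  refine le_trans ?_ (le_abs_self _)
  rw [Matrix.diag_apply, hx]
  refine (Finset.abs_sum_le_sum_abs _ _).trans ?_
  refine Finset.sum_le_sum fun k _ => ?_
  have h0 := (Matrix.toEuclideanLin x).singularValues_nonneg k
  rw [abs_mul, abs_of_nonneg h0, mul_comm]
  exact mul_le_mul_of_nonneg_right (abs_mul_le_half_add_sq _ _) h0

theorem schattenNorm_diagonal {p : ℝ≥0∞} (hp : 1 ≤ p) (v : Fin n → ℝ) :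
    schattenNorm p (Matrix.diagonal v) = lpNorm p v := by
  refine le_antisymm ?_ ?_
  -- The same argument reversed: here `σ k = ∑ i, U k i * V k i * v i`.
  · obtain ⟨U, V, hU, hV, -, hs⟩ := exists_singularValueDecomposition_coord (Matrix.diagonal v)
    have hP := mem_doublyStochastic_of_sq hU.1 (sum_sq_eq_one_of_parseval hU.2) hV.1
      (sum_sq_eq_one_of_parseval hV.2)
    refine le_trans (lpNorm_mono (w := Matrix.mulVec _ fun i => |v i|) hp fun k => ?_)
      ((lpNorm_mulVec_le hp hP fun i => |v i|).trans (lpNorm_mono hp fun i => (abs_abs _).le))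
    refine le_trans ?_ (le_abs_self _)
    rw [hs]
    refine (Finset.abs_sum_le_sum_abs _ _).trans ?_
    refine Finset.sum_le_sum fun i _ => ?_
    have : U k i * ∑ j, Matrix.diagonal v i j * V k j = (U k i * V k i) * v i := by
      rw [Finset.sum_eq_single i]
      · rw [Matrix.diagonal_apply_eq]; ring
      · intro j _ hj; rw [Matrix.diagonal_apply_ne _ (Ne.symm hj), zero_mul]
      · simp
    rw [this, abs_mul]
    exact mul_le_mul_of_nonneg_right (abs_mul_le_half_add_sq _ _) (abs_nonneg _)
  · simpa using lpNorm_diag_le_schattenNorm hp (Matrix.diagonal v)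

theorem abs_entry_le_schattenNorm {p : ℝ≥0∞} (hp : 1 ≤ p) (x : Matrix (Fin n) (Fin n) ℝ)
    (i j : Fin n) : |x i j| ≤ schattenNorm p x := by
  obtain ⟨U, V, hU, hV, hx, -⟩ := exists_singularValueDecomposition_coord x
  rw [hx]
  calc _ ≤ ∑ k : Fin n, |(Matrix.toEuclideanLin x).singularValues k * (U k i * V k j)| :=
        Finset.abs_sum_le_sum_abs _ _
    _ ≤ ∑ k, schattenNorm p x * ((U k i ^ 2 + V k j ^ 2) / 2) := by
        gcongr with k
        rw [abs_mul]
        have h1 : |(Matrix.toEuclideanLin x).singularValues k| ≤ schattenNorm p x :=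
          abs_le_lpNorm hp (fun i : Fin n => (Matrix.toEuclideanLin x).singularValues i) k
        have := schattenNorm_nonneg hp x
        gcongr
        exact abs_mul_le_half_add_sq _ _
    _ = schattenNorm p x := by
        rw [← Finset.mul_sum, ← Finset.sum_div, Finset.sum_add_distrib,
          sum_sq_eq_one_of_parseval hU.2, sum_sq_eq_one_of_parseval hV.2]
        norm_num

theorem lpNorm_le_one_of_sum_le_one {p : ℝ≥0∞} (hp : 1 ≤ p) (hp' : p ≠ ∞) {s : Fin n → ℝ}
    (hs : ∀ k, 0 ≤ s k) (hsum : ∑ k, s k ≤ 1) : lpNorm p s ≤ 1 := by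
  have h1 : 1 ≤ p.toReal := by
    rw [← ENNReal.toReal_one]; exact ENNReal.toReal_mono hp' hp
  unfold lpNorm
  rw [PiLp.norm_eq_sum (by linarith)]
  refine Real.rpow_le_one (Finset.sum_nonneg fun i _ => by positivity) ?_ (by positivity)
  refine le_trans (Finset.sum_le_sum fun k _ => ?_) hsum
  have h2 : s k ≤ 1 :=
    (Finset.single_le_sum (fun j _ => hs j) (Finset.mem_univ k)).trans hsum
  change ‖s k‖ ^ p.toReal ≤ s k
  rw [Real.norm_of_nonneg (hs k)]
  rcases (hs k).eq_or_lt with h0 | h0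
  · rw [← h0, Real.zero_rpow (by linarith)]
  · simpa using Real.rpow_le_rpow_of_exponent_ge h0 h2 h1

/-- A matrix with a single nonzero row is in the unit ball of every Schatten norm as soon as this
row is in the Euclidean unit ball. -/
theorem schattenNorm_single_row_le_one {p : ℝ≥0∞} (hp : 1 ≤ p) (hp' : p ≠ ∞) (i₀ : Fin n)
    {v : Fin n → ℝ} (hv : ∑ j, v j ^ 2 ≤ 1) :
    schattenNorm p (Matrix.of fun i j => if i = i₀ then v j else 0) ≤ 1 := by
  set x : Matrix (Fin n) (Fin n) ℝ := Matrix.of fun i j => if i = i₀ then v j else 0 with hx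
  obtain ⟨U, V, hU, hV, -, hs⟩ := exists_singularValueDecomposition_coord x
  refine lpNorm_le_one_of_sum_le_one hp hp'
    (fun k => (Matrix.toEuclideanLin x).singularValues_nonneg k) ?_
  -- Each singular value is the product `U k i₀ * ⟪V k, v⟫`; by Parseval these bounds add up to at
  -- most 1, so even the trace norm is at most 1.
  have h1 : ∀ k : Fin n, (Matrix.toEuclideanLin x).singularValues k ≤
      (U k i₀ ^ 2 + (∑ j, V k j * v j) ^ 2) / 2 := by
    intro k
    have e : (Matrix.toEuclideanLin x).singularValues k = U k i₀ * ∑ j, V k j * v j := by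
      rw [hs, Finset.sum_eq_single i₀]
      · simp [hx, mul_comm]
      · intro i _ hi; simp [hx, hi]
      · simp
    rw [e]
    exact (le_abs_self _).trans (abs_mul_le_half_add_sq _ _)
  calc _ ≤ ∑ k, (U k i₀ ^ 2 + (∑ j, V k j * v j) ^ 2) / 2 := Finset.sum_le_sum fun k _ => h1 k
    _ = (1 + ∑ j, v j ^ 2) / 2 := by
        rw [← Finset.sum_div, Finset.sum_add_distrib, sum_sq_eq_one_of_parseval hU.2, hV.2]
    _ ≤ 1 := by linarith

/-- The factor norm induced by the Schatten norm via the diagonal map is the `p`-norm. -/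
theorem isLeast_schattenNorm_of_diag_eq {p : ℝ≥0∞} (hp : 1 ≤ p) (v : Fin n → ℝ) :
    IsLeast {r : ℝ | ∃ x : Matrix (Fin n) (Fin n) ℝ, x.diag = v ∧ schattenNorm p x = r}
      (lpNorm p v) := by
  refine ⟨⟨Matrix.diagonal v, Matrix.diag_diagonal v, schattenNorm_diagonal hp v⟩, ?_⟩
  rintro _ ⟨x, rfl, rfl⟩
  exact lpNorm_diag_le_schattenNorm hp x

end Schatten

end OracleComplexity

namespace OracleComplexity

/-! ### Transfer of lower bounds along linear maps -/

section Transfer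

/-- `D` maps the unit ball of `N` into that of `N'`, so pulling a form back along `D` does not
increase its conjugate norm. -/
theorem comp_mem_smoothFamily {E G : Type*} [NormedAddCommGroup E] [NormedSpace ℝ E]
    [NormedAddCommGroup G] [NormedSpace ℝ G] {N : E → ℝ} {N' : G → ℝ} (hN' : ∀ v, 0 ≤ N' v)
    (D : E →L[ℝ] G) (hD : ∀ x, N' (D x) ≤ N x) {κ L : ℝ} (hκ : 1 < κ) (hL : 0 < L) {f : G → ℝ}
    (hf : f ∈ smoothFamily N' κ L) : f ∘ D ∈ smoothFamily N κ L := by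
  obtain ⟨h1, h2, h3⟩ := hf
  have hd : ∀ x h, fderiv ℝ (f ∘ D) x h = fderiv ℝ f (D x) (D h) := by
    intro x h
    rw [fderiv_comp x (h1.differentiable one_ne_zero _) D.differentiableAt,
      ContinuousLinearMap.fderiv]
    rfl
  refine ⟨h1.comp D.contDiff, h2.comp_linearMap D.toLinearMap, fun x y => ?_⟩
  refine iSup₂_le fun h hh => ?_
  have e : (fderiv ℝ (f ∘ D) x - fderiv ℝ (f ∘ D) y) h =
      (fderiv ℝ f (D x) - fderiv ℝ f (D y)) (D h) := by
    simp only [sub_apply, hd]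
  rw [e]
  refine (le_iSup₂ (f := fun (h : G) (_ : N' h ≤ 1) =>
    (((fderiv ℝ f (D x) - fderiv ℝ f (D y)) h : ℝ) : EReal)) (D h) ((hD h).trans hh)).trans ?_
  refine (h3 (D x) (D y)).trans (EReal.coe_le_coe_iff.2 ?_)
  rw [← map_sub]
  have := hN' (D (x - y))
  gcongr
  exact hD _

variable {E G : Type*} {I : Type*}

/-- From a record over `G` whose answers are functions on `E`, recover the search point in `E`
that is produced by the method `M`. -/
def liftPoint (M : Method E I) (t : ℕ) (r : Fin t → G × (E → I)) : E :=
  M t fun τ =>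
    (liftPoint M τ fun s : Fin τ => r (s.castLE τ.isLt.le),
      (r τ).2 (liftPoint M τ fun s : Fin τ => r (s.castLE τ.isLt.le)))
termination_by t
decreasing_by all_goals exact τ.isLt

variable [NormedAddCommGroup E] [NormedSpace ℝ E] [NormedAddCommGroup G] [NormedSpace ℝ G]

/-- The method on `G` that follows the images of the search points of a method on `E`. -/
def liftMethod (D : E → G) (M : Method E I) : Method G (E → I) :=
  fun t r => D (liftPoint M t r)

/-- The oracle on `G` that simulates an oracle on `E`: the answer at `v` encodes the answers at all
points of the fibre of `D` over `v`. -/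
def fiberOracle {F : Set (E → ℝ)} {F' : Set (G → ℝ)} (D : E →L[ℝ] G)
    (hF : ∀ f ∈ F', f ∘ D ∈ F) (S : G → E) (O : F → E → I) : F' → G → E → I :=
  fun f v x => O ⟨_, hF f f.2⟩ (x + S (v - D x))

variable {F : Set (E → ℝ)} {F' : Set (G → ℝ)} {D : E →L[ℝ] G} (hF : ∀ f ∈ F', f ∘ D ∈ F)
  {S : G → E} (hS : ∀ v, D (S v) = v)

-- For every `x` the point `x + S (v - D x)` lies in the fibre over `v`, so agreement near `v` pulls
-- back to agreement near that point.
include hS in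
theorem isLocal_fiberOracle {O : F → E → I} (hO : IsLocal O) :
    IsLocal (fiberOracle D hF S O) := by
  intro v f g hfg
  funext x
  refine hO _ _ _ ?_
  have e : D (x + S (v - D x)) = v := by rw [map_add, hS, add_sub_cancel]
  have ht : Filter.Tendsto D (𝓝 (x + S (v - D x))) (𝓝 v) := by
    have := D.continuous.tendsto (x + S (v - D x))
    rwa [e] at this
  exact ht.eventually hfg

/-- The method on `G` sees only `D x`, yet the recursion rebuilds `x` itself. Since `S 0 = 0`, the
recorded answer evaluated at `x` is the true answer of `O` at `x`. -/
theorem liftPoint_record {O : F → E → I} (hS0 : S 0 = 0) (M : Method E I) (f : F') (t : ℕ) :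
    liftPoint M t (fun τ : Fin t =>
      (searchPoint (fiberOracle D hF S O) (liftMethod D M) f τ,
        fiberOracle D hF S O f
          (searchPoint (fiberOracle D hF S O) (liftMethod D M) f τ))) =
      searchPoint O M ⟨_, hF f f.2⟩ t := by
  induction t using Nat.strong_induction_on with
  | _ t ih =>
    rw [liftPoint, searchPoint]
    congr 1
    funext τ
    have h1 := ih τ τ.isLt
    have h2 : searchPoint (fiberOracle D hF S O) (liftMethod D M) f τ =
        D (searchPoint O M ⟨_, hF f f.2⟩ τ) := by
      rw [searchPoint]
      exact congrArg D h1
    simp only [Fin.val_castLE, h1]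
    rw [Prod.mk.injEq]
    refine ⟨rfl, ?_⟩
    rw [h2, fiberOracle, sub_self, hS0, add_zero]

/-- A lower bound on the risk that is valid for every local oracle is transferred from `G` to `E`
along a linear map `D : E → G` with a section. -/
theorem le_minimaxRisk_of_factor {E G : Type} [NormedAddCommGroup E] [NormedSpace ℝ E]
    [NormedAddCommGroup G] [NormedSpace ℝ G] {F : Set (E → ℝ)} {F' : Set (G → ℝ)}
    {D : E →L[ℝ] G} (hF : ∀ f ∈ F', f ∘ D ∈ F) {S : G → E} (hS : ∀ v, D (S v) = v)
    (hS0 : S 0 = 0) {X : Set E} {X' : Set G} (hDX : ∀ x ∈ X, D x ∈ X') (hSX : ∀ v ∈ X', S v ∈ X)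
    {T : ℕ} {r : EReal}
    (hr : ∀ (I : Type u) (O : F' → G → I), IsLocal O → r ≤ minimaxRisk F' X' O T)
    {I : Type u} {O : F → E → I} (hO : IsLocal O) : r ≤ minimaxRisk F X O T := by
  refine le_iInf₂ fun M hM => ?_
  have hsp : ∀ f : F', approxSolution (fiberOracle D hF S O)
      (liftMethod D M) f T = D (approxSolution O M ⟨_, hF f f.2⟩ T) := by
    intro f
    unfold approxSolution
    rw [searchPoint]
    exact congrArg D (liftPoint_record hF hS0 M f _)
  refine (hr (E → I) _ (isLocal_fiberOracle hF hS hO)).trans ?_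
  refine (iInf₂_le (liftMethod D M) fun f => ?_).trans ?_
  · rw [hsp]; exact hDX _ (hM _)
  · refine iSup_le fun f => le_trans ?_ (le_iSup _ ⟨_, hF f f.2⟩)
    rw [hsp]
    refine EReal.sub_le_sub le_rfl ?_
    refine le_iInf₂ fun v hv => ?_
    refine (iInf₂_le (S v) (hSX v hv)).trans ?_
    simp [hS]

end Transfer

/-! ### The lower bounds for the Schatten norms -/

section Bounds

variable {n T m : ℕ}

/-- The linear form that reads an entry of a matrix. -/
noncomputable def entryForm (i j : Fin n) : Matrix (Fin n) (Fin n) ℝ →L[ℝ] ℝ :=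
  LinearMap.toContinuousLinearMap (Matrix.entryLinearMap ℝ ℝ i j)

/-- The diagonal map. -/
noncomputable def diagMap (n : ℕ) : Matrix (Fin n) (Fin n) ℝ →L[ℝ] (Fin n → ℝ) :=
  LinearMap.toContinuousLinearMap (Matrix.diagLinearMap (Fin n) ℝ ℝ)

/-- For at most `exp m` coordinates the `m`-norm exceeds the maximum by a factor of at most `e < 3`.
-/
theorem sum_pow_le_of_le_exp (hm : (T : ℝ) ≤ Real.exp m) {c : Fin T → ℝ} {N : ℝ}
    (hc : ∀ i, |c i| ≤ N) (hN : 0 ≤ N) : ∑ i, |c i| ^ m ≤ (3 * N) ^ m := by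
  calc ∑ i, |c i| ^ m ≤ ∑ _i : Fin T, N ^ m := by
        gcongr with i; exact hc i
    _ = T * N ^ m := by simp
    _ ≤ Real.exp 1 ^ m * N ^ m := by
        rw [← Real.exp_nat_mul, mul_one]; gcongr
    _ ≤ 3 ^ m * N ^ m := by gcongr; exact Real.exp_one_lt_three.le
    _ = _ := by rw [mul_pow]

theorem sum_pow_le_lpNorm_pow {p : ℝ≥0∞} (hp : 1 ≤ p) (hp' : p ≠ ∞) (hpm : p.toReal ≤ m)
    (v : Fin n → ℝ) : ∑ i, |v i| ^ m ≤ lpNorm p v ^ m := by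
  have h0 : 0 < p.toReal := ENNReal.toReal_pos (by positivity) hp'
  have hN := lpNorm_nonneg hp v
  have hsplit : ∀ a : ℝ, 0 ≤ a → a ^ m = a ^ p.toReal * a ^ (m - p.toReal) := by
    intro a ha
    rw [← Real.rpow_add_of_nonneg ha h0.le (by linarith), add_sub_cancel, Real.rpow_natCast]
  have hsum : ∑ i, |v i| ^ p.toReal = lpNorm p v ^ p.toReal := by
    unfold lpNorm
    rw [PiLp.norm_eq_sum h0, ← Real.rpow_mul (Finset.sum_nonneg fun i _ => by positivity),
      one_div_mul_cancel h0.ne', Real.rpow_one]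
    rfl
  calc ∑ i, |v i| ^ m ≤ ∑ i, |v i| ^ p.toReal * lpNorm p v ^ (m - p.toReal) := by
        refine Finset.sum_le_sum fun i _ => ?_
        rw [hsplit _ (abs_nonneg _)]
        exact mul_le_mul_of_nonneg_left
          (Real.rpow_le_rpow (abs_nonneg _) (abs_le_lpNorm hp v i) (by linarith)) (by positivity)
    _ = lpNorm p v ^ m := by rw [← Finset.sum_mul, hsum, ← hsplit _ hN]

/-- Extension by zero of the vector `ρ • η`. -/
noncomputable def extendZero (n : ℕ) (ρ : ℝ) (η : Fin T → ℝ) (j : Fin n) : ℝ :=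
  if h : (j : ℕ) < T then ρ * η ⟨j, h⟩ else 0

theorem extendZero_castLE (h : T ≤ n) (ρ : ℝ) (η : Fin T → ℝ) (i : Fin T) :
    extendZero n ρ η (i.castLE h) = ρ * η i := by
  simp [extendZero]

theorem abs_extendZero {ρ : ℝ} (hρ : 0 ≤ ρ) {η : Fin T → ℝ} (hη : ∀ i, |η i| = 1) (j : Fin n) :
    |extendZero n ρ η j| = if (j : ℕ) < T then ρ else 0 := by
  unfold extendZero
  split_ifs
  · rw [abs_mul, hη, mul_one, abs_of_nonneg hρ]
  · exact abs_zero

theorem sum_abs_extendZero_rpow (h : T ≤ n) {ρ : ℝ} (hρ : 0 ≤ ρ) {η : Fin T → ℝ}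
    (hη : ∀ i, |η i| = 1) {q : ℝ} (hq : 0 < q) :
    ∑ j, |extendZero n ρ η j| ^ q = T * ρ ^ q := by
  simp only [abs_extendZero hρ hη]
  rw [Fin.sum_univ_eq_sum_range (fun j => (if j < T then ρ else 0) ^ q) n,
    ← Finset.sum_subset (Finset.range_mono h)]
  · rw [Finset.sum_congr rfl fun j hj => by rw [if_pos (Finset.mem_range.1 hj)]]
    simp
  · intro j _ hj
    rw [if_neg (by simpa using hj), Real.zero_rpow hq.ne']

/-- For `p = ∞` the exponent `(p⁻¹).toReal` is 0, so the nonzero entries are `±1`. -/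
theorem lpNorm_extendZero_le_one {p : ℝ≥0∞} (hp : 1 ≤ p) (hT : 1 ≤ T) (h : T ≤ n)
    {η : Fin T → ℝ} (hη : ∀ i, |η i| = 1) :
    lpNorm p (extendZero n ((T : ℝ) ^ (-(p⁻¹).toReal)) η) ≤ 1 := by
  have hT0 : (0 : ℝ) < T := by exact_mod_cast hT
  have hρ : (0 : ℝ) ≤ (T : ℝ) ^ (-(p⁻¹).toReal) := by positivity
  unfold lpNorm
  rcases eq_or_ne p ∞ with rfl | hp'
  · rw [PiLp.norm_eq_ciSup]
    refine Real.iSup_le (fun i => ?_) zero_le_one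
    change |extendZero n _ η i| ≤ 1
    rw [abs_extendZero hρ hη]
    split_ifs <;> simp
  · have h0 : 0 < p.toReal := ENNReal.toReal_pos (by positivity) hp'
    rw [PiLp.norm_eq_sum h0]
    refine Real.rpow_le_one (Finset.sum_nonneg fun i _ => by positivity) ?_ (by positivity)
    refine ((sum_abs_extendZero_rpow h hρ hη h0).trans ?_).le
    rw [← Real.rpow_mul hT0.le, ENNReal.toReal_inv, neg_mul, inv_mul_cancel₀ h0.ne',
      Real.rpow_neg_one, mul_inv_cancel₀ hT0.ne']

theorem max_two_ceil_le {μ : ℝ} (hμ : Real.log 2 ≤ μ) :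
    ((max 2 ⌈μ⌉₊ : ℕ) : ℝ) ≤ 4 * μ := by
  have h2 := Real.log_two_gt_d9
  have h3 := Nat.ceil_lt_add_one (a := μ) (by linarith)
  rw [Nat.cast_max]
  refine max_le ?_ ?_
  · push_cast; linarith
  · linarith

/-- With `K = 3`: `12 ^ κ ≤ 144`, `4 ^ (κ - 1) ≤ 4`, and `2304 = 4 * 144 * 4`. -/
theorem bound_le {κ L μ s : ℝ} (hκ : 1 < κ) (hκ2 : κ ≤ 2) (hL : 0 < L) (hμ : 0 < μ)
    (hT : 1 ≤ T) (hm : 2 ≤ m) (hmμ : (m : ℝ) ≤ 4 * μ) :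
    1 / 2304 / μ ^ (κ - 1) * (L / (T : ℝ) ^ (κ + κ * s - 1)) ≤
      L * ((T : ℝ) ^ (-s)) ^ κ / (4 * (4 * 3) ^ κ * (m * T) ^ (κ - 1)) := by
  have hT0 : (0 : ℝ) < T := by exact_mod_cast hT
  have hm0 : (0 : ℝ) < m := by positivity
  have e1 : ((T : ℝ) ^ (-s)) ^ κ = ((T : ℝ) ^ (κ * s))⁻¹ := by
    rw [← Real.rpow_mul hT0.le, ← Real.rpow_neg hT0.le]; congr 1; ring
  have e2 : (T : ℝ) ^ (κ + κ * s - 1) = (T : ℝ) ^ (κ - 1) * (T : ℝ) ^ (κ * s) := by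
    rw [← Real.rpow_add hT0]; congr 1; ring
  have h1 : (4 * 3 : ℝ) ^ κ ≤ 144 := by
    calc (4 * 3 : ℝ) ^ κ ≤ (4 * 3 : ℝ) ^ (2 : ℝ) :=
          Real.rpow_le_rpow_of_exponent_le (by norm_num) hκ2
      _ = 144 := by rw [Real.rpow_two]; norm_num
  have h2 : ((m : ℝ) * T) ^ (κ - 1) ≤ 4 * μ ^ (κ - 1) * (T : ℝ) ^ (κ - 1) := by
    calc ((m : ℝ) * T) ^ (κ - 1) ≤ (4 * μ * T) ^ (κ - 1) := by
          have : 0 ≤ κ - 1 := by linarith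
          gcongr
      _ = 4 ^ (κ - 1) * μ ^ (κ - 1) * (T : ℝ) ^ (κ - 1) := by
          rw [Real.mul_rpow (by positivity) hT0.le, Real.mul_rpow (by norm_num) hμ.le]
      _ ≤ 4 * μ ^ (κ - 1) * (T : ℝ) ^ (κ - 1) := by
          gcongr
          calc (4 : ℝ) ^ (κ - 1) ≤ (4 : ℝ) ^ (1 : ℝ) :=
                Real.rpow_le_rpow_of_exponent_le (by norm_num) (by linarith)
            _ = 4 := Real.rpow_one 4
  have h3 : 4 * (4 * 3 : ℝ) ^ κ * ((m : ℝ) * T) ^ (κ - 1) ≤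
      4 * 144 * (4 * μ ^ (κ - 1) * (T : ℝ) ^ (κ - 1)) := by gcongr
  rw [e1, e2]
  calc _ = L * ((T : ℝ) ^ (κ * s))⁻¹ / (4 * 144 * (4 * μ ^ (κ - 1) * (T : ℝ) ^ (κ - 1))) := by
        field_simp
        norm_num
    _ ≤ _ := by gcongr

theorem schatten_risk_transfer {p : ℝ≥0∞} (hp : 1 ≤ p) {κ L : ℝ} (hκ : 1 < κ) (hL : 0 < L)
    {r : EReal}
    (hr : ∀ (I : Type u) (O : smoothFamily (lpNorm (n := n) p) κ L → (Fin n → ℝ) → I),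
      IsLocal O → r ≤ minimaxRisk (smoothFamily (lpNorm p) κ L) {x | lpNorm p x ≤ 1} O T)
    {I : Type u} {O : smoothFamily (schattenNorm (n := n) p) κ L → Matrix (Fin n) (Fin n) ℝ → I}
    (hO : IsLocal O) :
    r ≤ minimaxRisk (smoothFamily (schattenNorm p) κ L) {x | schattenNorm p x ≤ 1} O T := by
  refine le_minimaxRisk_of_factor (D := diagMap n) (S := Matrix.diagonal)
    (fun f hf => comp_mem_smoothFamily (lpNorm_nonneg hp) (diagMap n)
      (lpNorm_diag_le_schattenNorm hp) hκ hL hf)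
    Matrix.diag_diagonal Matrix.diagonal_zero
    (fun x hx => (lpNorm_diag_le_schattenNorm hp x).trans hx)
    (fun v hv => (schattenNorm_diagonal hp v).le.trans hv) hr hO

theorem schatten_risk_lower_bound_of_two_le {p : ℝ≥0∞} {κ L : ℝ} (hn : 2 ≤ n) (hT : 1 ≤ T)
    (hTn : T ≤ n) (hp2 : 2 ≤ p) (hκ : 1 < κ) (hκ2 : κ ≤ 2) (hL : 0 < L)
    {X : Set (Matrix (Fin n) (Fin n) ℝ)} (hX : {x | schattenNorm p x ≤ 1} ⊆ X) {I : Type*}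
    {O : smoothFamily (schattenNorm (n := n) p) κ L → Matrix (Fin n) (Fin n) ℝ → I}
    (hO : IsLocal O) :
    ((1 / 2304 / (min p (ENNReal.ofReal (Real.log n))).toReal ^ (κ - 1) *
        (L / (T : ℝ) ^ (κ + κ * (p⁻¹).toReal - 1)) : ℝ) : EReal) ≤
      minimaxRisk (smoothFamily (schattenNorm p) κ L) X O T := by
  have hp : 1 ≤ p := le_trans (by norm_num) hp2
  have hn0 : (0 : ℝ) < n := by positivity
  have hlog : Real.log 2 ≤ Real.log n :=
    Real.log_le_log (by norm_num) (by exact_mod_cast hn)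
  have hlog2 := Real.log_two_gt_d9
  set μ := (min p (ENNReal.ofReal (Real.log n))).toReal with hμ
  set m := max 2 ⌈μ⌉₊ with hm
  have hμm : μ ≤ m := (Nat.le_ceil μ).trans (by exact_mod_cast le_max_right _ _)
  have key : Real.log 2 ≤ μ ∧ ∀ x : Matrix (Fin n) (Fin n) ℝ,
      ∑ i : Fin T, |entryForm (i.castLE hTn) (i.castLE hTn) x| ^ m ≤
        (3 * schattenNorm p x) ^ m := by
    -- If `p ≤ log n`, then `m ≥ p` and the `m`-norm of the diagonal is at most its `p`-norm.
    -- Otherwise `T ≤ n ≤ exp m`, and bounding single entries is enough.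
    rcases le_total p (ENNReal.ofReal (Real.log n)) with h | h
    · have hp' : p ≠ ∞ := ne_top_of_le_ne_top ENNReal.ofReal_ne_top h
      have hμp : μ = p.toReal := by rw [hμ, min_eq_left h]
      constructor
      · have : (2 : ℝ) ≤ p.toReal := by
          rw [← ENNReal.toReal_ofNat]; exact ENNReal.toReal_mono hp' hp2
        have := Real.log_two_lt_d9
        rw [hμp]; linarith
      · intro x
        have hN := schattenNorm_nonneg hp x
        calc ∑ i : Fin T, |entryForm (i.castLE hTn) (i.castLE hTn) x| ^ m =
              ∑ j ∈ Finset.univ.map (Fin.castLEEmb hTn), |x.diag j| ^ m := by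
              rw [Finset.sum_map]; rfl
          _ ≤ ∑ j, |x.diag j| ^ m :=
              Finset.sum_le_sum_of_subset_of_nonneg (Finset.subset_univ _)
                fun _ _ _ => by positivity
          _ ≤ lpNorm p x.diag ^ m := sum_pow_le_lpNorm_pow hp hp' (hμp ▸ hμm) _
          _ ≤ (3 * schattenNorm p x) ^ m := by
              have := lpNorm_nonneg hp x.diag
              have := lpNorm_diag_le_schattenNorm hp x
              gcongr
              linarith
    · have hμl : μ = Real.log n := by
        rw [hμ, min_eq_right h, ENNReal.toReal_ofReal (by linarith)]
      refine ⟨hμl ▸ hlog, fun x => ?_⟩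
      refine sum_pow_le_of_le_exp ?_ (fun i => abs_entry_le_schattenNorm hp x _ _)
        (schattenNorm_nonneg hp x)
      calc (T : ℝ) ≤ n := by exact_mod_cast hTn
        _ = Real.exp (Real.log n) := (Real.exp_log hn0).symm
        _ ≤ _ := by rw [← hμl]; gcongr
  have hT0 : (0 : ℝ) < T := by exact_mod_cast hT
  refine le_trans (EReal.coe_le_coe_iff.2 (bound_le (m := m) hκ hκ2 hL (by linarith [key.1]) hT
    (le_max_left _ _) (max_two_ceil_le key.1))) ?_
  refine le_minimaxRisk_of_forms (le_max_left _ _) hT (schattenNorm_nonneg hp) (by norm_num)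
    key.2 hκ hκ2 hL (by positivity) (fun η hη => ?_) hO
  refine ⟨Matrix.diagonal (extendZero n ((T : ℝ) ^ (-(p⁻¹).toReal)) η), hX ?_, fun i => ?_⟩
  · exact (schattenNorm_diagonal hp _).le.trans (lpNorm_extendZero_le_one hp hT hTn hη)
  · exact (Matrix.diagonal_apply_eq _ _).trans (extendZero_castLE hTn _ η i)

/-- Only the `T` entries of one row matter, so `m` of order `log (T + 1)` suffices and the ambient
dimension does not enter. -/
theorem schatten_risk_lower_bound_of_le_two {p : ℝ≥0∞} {κ L : ℝ} (hT : 1 ≤ T) (hTn : T ≤ n)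
    (hp : 1 ≤ p) (hp2 : p ≤ 2) (hκ : 1 < κ) (hκ2 : κ ≤ 2) (hL : 0 < L)
    {X : Set (Matrix (Fin n) (Fin n) ℝ)} (hX : {x | schattenNorm p x ≤ 1} ⊆ X) {I : Type*}
    {O : smoothFamily (schattenNorm (n := n) p) κ L → Matrix (Fin n) (Fin n) ℝ → I}
    (hO : IsLocal O) :
    ((1 / 2304 * (L / (Real.log ((T : ℝ) + 1) ^ (κ - 1) * (T : ℝ) ^ (3 * κ / 2 - 1))) : ℝ) :
        EReal) ≤ minimaxRisk (smoothFamily (schattenNorm p) κ L) X O T := by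
  have hp' : p ≠ ∞ := ne_top_of_le_ne_top (by norm_num) hp2
  have hT0 : (0 : ℝ) < T := by exact_mod_cast hT
  have hT1 : (1 : ℝ) ≤ T := by exact_mod_cast hT
  set μ := Real.log ((T : ℝ) + 1) with hμ
  have hlog : Real.log 2 ≤ μ := Real.log_le_log (by norm_num) (by linarith)
  have hμ0 : 0 < μ := (Real.log_pos (by norm_num)).trans_le hlog
  set m := max 2 ⌈μ⌉₊ with hm
  have hμm : μ ≤ m := (Nat.le_ceil μ).trans (by exact_mod_cast le_max_right _ _)
  let i₀ : Fin n := ⟨0, by omega⟩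
  have e : 1 / 2304 * (L / (μ ^ (κ - 1) * (T : ℝ) ^ (3 * κ / 2 - 1))) =
      1 / 2304 / μ ^ (κ - 1) * (L / (T : ℝ) ^ (κ + κ * (1 / 2) - 1)) := by
    rw [show κ + κ * (1 / 2) - 1 = 3 * κ / 2 - 1 by ring]
    field_simp
  rw [e]
  refine le_trans (EReal.coe_le_coe_iff.2 (bound_le (m := m) hκ hκ2 hL hμ0 hT
    (le_max_left _ _) (max_two_ceil_le hlog))) ?_
  refine le_minimaxRisk_of_forms (a := fun i : Fin T => entryForm i₀ (i.castLE hTn))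
    (le_max_left _ _) hT (schattenNorm_nonneg hp) (by norm_num) (fun x => ?_) hκ hκ2 hL
    (by positivity) (fun η hη => ?_) hO
  · refine sum_pow_le_of_le_exp ?_ (fun i => abs_entry_le_schattenNorm hp x _ _)
      (schattenNorm_nonneg hp x)
    calc (T : ℝ) ≤ T + 1 := by linarith
      _ = Real.exp μ := (Real.exp_log (by linarith)).symm
      _ ≤ _ := by gcongr
  · refine ⟨Matrix.of fun i j => if i = i₀ then extendZero n ((T : ℝ) ^ (-(1 / 2 : ℝ))) η j else 0,
      hX (schattenNorm_single_row_le_one hp hp' i₀ ?_), fun i => ?_⟩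
    · have h := sum_abs_extendZero_rpow hTn (ρ := (T : ℝ) ^ (-(1 / 2 : ℝ))) (by positivity) hη
        two_pos
      rw [← Real.rpow_mul hT0.le, show -(1 / 2 : ℝ) * 2 = -1 by norm_num, Real.rpow_neg_one,
        mul_inv_cancel₀ hT0.ne'] at h
      simp only [Real.rpow_two, sq_abs] at h
      exact h.le
    · change (if i₀ = i₀ then extendZero n ((T : ℝ) ^ (-(1 / 2 : ℝ))) η (i.castLE hTn) else 0) = _
      rw [if_pos rfl, extendZero_castLE]

end Bounds

end OracleComplexity

/-! ### The four statements together. -/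

open OracleComplexity in
theorem mainTheorem5 :
    -- the factor norm on `ℝⁿ` induced by the Schatten norm via the diagonal map is the `p`-norm
    (∀ (n : ℕ) (p : ℝ≥0∞), 1 ≤ p → ∀ v : Fin n → ℝ,
      IsLeast {r : ℝ | ∃ x : Matrix (Fin n) (Fin n) ℝ, x.diag = v ∧ schattenNorm p x = r}
        (lpNorm p v)) ∧
    -- universal lower bounds for the unit `p`-ball are universal lower bounds for the Schatten ball
    (∀ (n T : ℕ) (p : ℝ≥0∞) (κ L : ℝ), 1 ≤ T → 1 ≤ p → 1 < κ → κ ≤ 2 → 0 < L →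
      ∀ r : EReal,
        (∀ (I : Type u) (O : smoothFamily (lpNorm (n := n) p) κ L → (Fin n → ℝ) → I), IsLocal O →
          r ≤ minimaxRisk (smoothFamily (lpNorm p) κ L) {x | lpNorm p x ≤ 1} O T) →
        ∀ (I : Type u) (O : smoothFamily (schattenNorm (n := n) p) κ L →
            Matrix (Fin n) (Fin n) ℝ → I), IsLocal O →
          r ≤ minimaxRisk (smoothFamily (schattenNorm p) κ L) {x | schattenNorm p x ≤ 1} O T) ∧
    -- the case `2 ≤ p ≤ ∞`
    (∃ c : ℝ, 0 < c ∧
      ∀ (n T : ℕ) (p : ℝ≥0∞) (κ L : ℝ), 2 ≤ n → 1 ≤ T → T ≤ n → 2 ≤ p →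
        1 < κ → κ ≤ 2 → 0 < L →
        ∀ X : Set (Matrix (Fin n) (Fin n) ℝ), Convex ℝ X → {x | schattenNorm p x ≤ 1} ⊆ X →
        ∀ (I : Type u) (O : smoothFamily (schattenNorm (n := n) p) κ L →
            Matrix (Fin n) (Fin n) ℝ → I), IsLocal O →
          ((c / (min p (ENNReal.ofReal (Real.log n))).toReal ^ (κ - 1) *
              (L / (T : ℝ) ^ (κ + κ * (p⁻¹).toReal - 1)) : ℝ) : EReal) ≤
            minimaxRisk (smoothFamily (schattenNorm p) κ L) X O T) ∧
    -- the case `1 ≤ p ≤ 2`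
    (∃ c α : ℝ, 0 < c ∧ 0 < α ∧ α < 1 ∧
      ∀ (n T : ℕ) (p : ℝ≥0∞) (κ L : ℝ), 1 ≤ T → (T : ℝ) ≤ α * n → 1 ≤ p → p ≤ 2 →
        1 < κ → κ ≤ 2 → 0 < L →
        ∀ X : Set (Matrix (Fin n) (Fin n) ℝ), Convex ℝ X → {x | schattenNorm p x ≤ 1} ⊆ X →
        ∀ (I : Type u) (O : smoothFamily (schattenNorm (n := n) p) κ L →
            Matrix (Fin n) (Fin n) ℝ → I), IsLocal O →
          ((c * (L / (Real.log ((T : ℝ) + 1) ^ (κ - 1) *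
              (T : ℝ) ^ (3 * κ / 2 - 1))) : ℝ) : EReal) ≤
            minimaxRisk (smoothFamily (schattenNorm p) κ L) X O T) := by
  refine ⟨fun n p hp v => isLeast_schattenNorm_of_diag_eq hp v, ?_, ⟨1 / 2304, by norm_num, ?_⟩,
    -- Any `α` in `(0, 1)` would do, since the one-row construction needs only `T ≤ n`.
    ⟨1 / 2304, 1 / 2, by norm_num, by norm_num, by norm_num, ?_⟩⟩
  · intro n T p κ L _ hp hκ _ hL r hr I O hO
    exact schatten_risk_transfer hp hκ hL hr hO
  · intro n T p κ L hn hT hTn hp hκ hκ2 hL X _ hX I O hO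
    exact schatten_risk_lower_bound_of_two_le hn hT hTn hp hκ hκ2 hL hX hO
  · intro n T p κ L hT hTn hp hp2 hκ hκ2 hL X _ hX I O hO
    have h : T ≤ n := by
      have h0 : (0 : ℝ) ≤ n := by positivity
      have : (T : ℝ) ≤ n := by linarith
      exact_mod_cast this
    exact schatten_risk_lower_bound_of_le_two hT h hp hp2 hκ hκ2 hL hX hO
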